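/- Let $T>0$, let $0\le t_1\le\dots\le t_K\le T$ be observation times, let $\Omega\subseteq\mathbb R^l$ be open (for instance $\Omega=\mathbb R^l$) and $\varphi_0\in\mathbb R^l$. Let $f:\mathbb R^N\times\Omega\to\mathbb R^l$ be $C^1$, let $g:\Omega\to\mathbb R^{N\times N}$ be $C^1$ with symmetric values, and let $F_1,\dots,F_K:\Omega\to\mathbb R$ be differentiable. Controls are the elements $u$ of $\mathcal U=L^\infty([0,T];\mathbb R^N)$; a solution of the forward equation for $u$ is an absolutely continuous $\varphi:[0,T]\to\Omega$ with $\dot\varphi(t)=f(u(t),\varphi(t))$ for almost every $t$ and $\varphi(0)=\varphi_0$. Put $L(u,\varphi)=\tfrac12u^\top g(\varphi)u$ and $$J[u]=\int_0^T L(u(t),\varphi(t))\,dt-\sum_{k=1}^K F_k(\varphi(t_k)),$$ where $\varphi$ is the solution for $u$. For a symmetric bilinear form $G$ on $\mathcal U$ and $h>0$, a steepest descent update of $u$ with step size $h$ is a $u'\in\mathcal U$ such that, for some $\epsilon$, $u'$ minimizes the linearization $w\mapsto J[u]+\delta J[u,w-u]$ over all $w\in\mathcal U$ with $\tfrac12G(w-u,w-u)=\epsilon$,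 and $u'$ is a stationary point of the Lagrangian of this constrained problem for the multiplier $\lambda=1/h$; here $\delta J$ is the Gateaux derivative. It is called a regular gradient descent update if $G(v,w)=\int_0^Tv(t)^\top w(t)\,dt$, and a natural gradient descent update if $G$ is the metric at $u$ given by the path-wise Fisher information $G(u)[v,w]=\int_0^Tv(t)^\top g(\varphi(t))w(t)\,dt$, where $\varphi$ is the solution for $u$. For each control the solution of the forward equation is unique if it exists, so that $J[u]$ is well defined where a solution exists. Let $u\in\mathcal U$ be a control for which the solution $\varphi$ exists on $[0,T]$. Then: 1. For every $v\in\mathcal U$ the forward equation for $u+sv$ has a solution on $[0,T]$ for all sufficiently small $|s|$. 2. There is exactly one right-continuous $\eta:[0,T]\to\mathbb R^l$ that solves the adjoint equation $$\dot\eta(t)=L_\varphi(u(t),\varphi(t))-f_\varphi(u(t),\varphi(t))^\top\eta(t)$$ between the observation times (in the same almost-everywhere sense), jumps at the observation times according to $\eta(t^-)=\eta(t^+)+\sum_{k:\,t_k=t}\nabla F_k(\varphi(t))$ for $0<t\le T$, and satisfies $\eta(T)=\eta(T^+)=0$. 3. For every $v\in\mathcal U$ the Gateaux derivative of $J$ at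 $u$ exists and equals $$\delta J[u,v]=\int_0^T\big(g(\varphi(t))u(t)-f_u(u(t),\varphi(t))^\top\eta(t)\big)^\top v(t)\,dt ,$$ and for every $h>0$ the regular gradient descent update of $u$ with step size $h$ is, uniquely up to null sets, $$u'(t)=u(t)-h\big(g(\varphi(t))u(t)-f_u(u(t),\varphi(t))^\top\eta(t)\big).$$ 4. If moreover $g(\varphi(t))$ is positive definite for all $t\in[0,T]$, then $\delta J[u,v]=G(u)\big[u-g(\varphi)^{-1}f_u^\top\eta,\;v\big]$ for every $v\in\mathcal U$, and for every $h>0$ the natural gradient descent update of $u$ with step size $h$ is, uniquely up to null sets, $$u'(t)=u(t)-h\big(u(t)-g(\varphi(t))^{-1}f_u(u(t),\varphi(t))^\top\eta(t)\big).$$ -/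

import Mathlib

open MeasureTheory Set Filter Topology

noncomputable section

/-- Time-dependent vectors `ℝ → ℝᵈ`; only their values on the time horizon `[0, T]` matter. -/
abbrev Signal (d : ℕ) := ℝ → EuclideanSpace ℝ (Fin d)

/-- The data of the control problem: minimise
`∫₀ᵀ ½ u(t)ᵀ g(φ(t)) u(t) dt - ∑ₖ Fₖ(φ(tₖ))` subject to `φ' = f(u, φ)`, `φ(0) = φ₀`,
with controls in `ℝᴺ` and moments in an open set `Ω ⊆ ℝˡ` on which `f`, `g`, `Fₖ` are regular. -/
structure ControlProblem (N l K : ℕ) where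
  /-- time horizon -/
  T : ℝ
  T_pos : 0 < T
  /-- observation times -/
  obs : Fin K → ℝ
  obs_mem : ∀ k, obs k ∈ Icc 0 T
  obs_mono : Monotone obs
  /-- domain of the moments -/
  Ω : Set (EuclideanSpace ℝ (Fin l))
  isOpen_Ω : IsOpen Ω
  /-- initial moments -/
  φ₀ : EuclideanSpace ℝ (Fin l)
  /-- right-hand side of the forward equation -/
  f : EuclideanSpace ℝ (Fin N) → EuclideanSpace ℝ (Fin l) → EuclideanSpace ℝ (Fin l)
  contDiffOn_f : ContDiffOn ℝ 1
    (fun p : EuclideanSpace ℝ (Fin N) × EuclideanSpace ℝ (Fin l) => f p.1 p.2) (univ ×ˢ Ω)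
  /-- matrix of the quadratic running cost -/
  g : EuclideanSpace ℝ (Fin l) → Matrix (Fin N) (Fin N) ℝ
  contDiffOn_g : ∀ i j, ContDiffOn ℝ 1 (fun x => g x i j) Ω
  g_symm : ∀ x ∈ Ω, (g x).IsSymm
  /-- contributions of the observations -/
  F : Fin K → EuclideanSpace ℝ (Fin l) → ℝ
  differentiableOn_F : ∀ k, DifferentiableOn ℝ (F k) Ω

/-- The product of a square matrix and a vector of Euclidean space. -/
def matVec {N : ℕ} (A : Matrix (Fin N) (Fin N) ℝ) (w : EuclideanSpace ℝ (Fin N)) :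
    EuclideanSpace ℝ (Fin N) :=
  Matrix.toEuclideanCLM (n := Fin N) (𝕜 := ℝ) A w

section Descent

variable {N : ℕ}

/-- The Gateaux derivative `δJ[u, v]` of a functional `J` of the control. -/
def gateaux (J : Signal N → ℝ) (u v : Signal N) : ℝ :=
  deriv (fun s : ℝ => J (u + s • v)) 0

/-- The Lagrangian
`J[u] + δJ[u, w - u] + c (½ G(w - u, w - u) - ε)` of the linearised problem at `u`. -/
def lagrangian (J : Signal N → ℝ) (G : Signal N → Signal N → ℝ) (u : Signal N)
    (ε c : ℝ) (w : Signal N) : ℝ :=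
  J u + gateaux J u (w - u) + c * (1 / 2 * G (w - u) (w - u) - ε)

/-- `u'` is a steepest descent update of `u` for the functional `J` on the space `𝒰` of controls,
with respect to the metric `G` at `u` and with step size `h`: for some `ε`, it minimises the
linearisation of `J` at `u` among the controls `w` with `½ G(w - u, w - u) = ε`, and it is a
stationary point of the Lagrangian of this problem for the multiplier `1 / h`. -/
def IsSteepestDescentUpdate (𝒰 : Set (Signal N)) (J : Signal N → ℝ)
    (G : Signal N → Signal N → ℝ) (u : Signal N) (h : ℝ) (u' : Signal N) : Prop :=
  u' ∈ 𝒰 ∧ ∃ ε : ℝ, 1 / 2 * G (u' - u) (u' - u) = ε ∧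
    (∀ w ∈ 𝒰, 1 / 2 * G (w - u) (w - u) = ε →
      J u + gateaux J u (u' - u) ≤ J u + gateaux J u (w - u)) ∧
    ∀ v ∈ 𝒰, HasDerivAt (fun s : ℝ => lagrangian J G u ε (1 / h) (u' + s • v)) 0 0

end Descent

namespace ControlProblem

variable {N l K : ℕ} (P : ControlProblem N l K)

/-- Lebesgue measure on the time horizon. -/
def timeMeasure : Measure ℝ := volume.restrict (Icc 0 P.T)

/-- The space of controls: (essentially) bounded measurable functions on `[0, T]`. -/
def controls : Set (Signal N) := {u | MemLp u ⊤ P.timeMeasure}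

/-- The running cost `L(u, φ) = ½ uᵀ g(φ) u`. -/
def L (w : EuclideanSpace ℝ (Fin N)) (x : EuclideanSpace ℝ (Fin l)) : ℝ :=
  1 / 2 * inner ℝ w (matVec (P.g x) w)

/-- `φ` solves `φ' = f(u, φ)`, `φ(0) = φ₀` on `[0, T]` in the sense of Carathéodory. -/
def IsForwardSolution (u : Signal N) (φ : Signal l) : Prop :=
  ContinuousOn φ (Icc 0 P.T) ∧ (∀ t ∈ Icc 0 P.T, φ t ∈ P.Ω) ∧
    ∀ t ∈ Icc 0 P.T, φ t = P.φ₀ + ∫ s in (0 : ℝ)..t, P.f (u s) (φ s)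

/-- The objective `J[u, φ]`. -/
def objective (u : Signal N) (φ : Signal l) : ℝ :=
  (∫ t in (0 : ℝ)..P.T, P.L (u t) (φ t)) - ∑ k, P.F k (φ (P.obs k))

open Classical in
/-- The objective as a functional `J[u]` of the control alone: `J[u, φ]` for the solution `φ` of
the forward equation driven by `u` (and `0` if the forward equation has no solution). -/
def reducedObjective (u : Signal N) : ℝ :=
  if h : ∃ φ, P.IsForwardSolution u φ then P.objective u h.choose else 0

/-- The Jacobian `f_u` along `(u, φ)`. -/
def fu (u : Signal N) (φ : Signal l) (t : ℝ) :
    EuclideanSpace ℝ (Fin N) →L[ℝ] EuclideanSpace ℝ (Fin l) :=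
  fderiv ℝ (fun w => P.f w (φ t)) (u t)

/-- The Jacobian `f_φ` along `(u, φ)`. -/
def fφ (u : Signal N) (φ : Signal l) (t : ℝ) :
    EuclideanSpace ℝ (Fin l) →L[ℝ] EuclideanSpace ℝ (Fin l) :=
  fderiv ℝ (fun x => P.f (u t) x) (φ t)

/-- The gradient `L_φ` along `(u, φ)`. -/
def Lφ (u : Signal N) (φ : Signal l) (t : ℝ) : EuclideanSpace ℝ (Fin l) :=
  gradient (fun x => P.L (u t) x) (φ t)

/-- The right-hand side `L_φ - f_φᵀ η` of the adjoint equation. -/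
def adjointRhs (u : Signal N) (φ η : Signal l) (t : ℝ) : EuclideanSpace ℝ (Fin l) :=
  P.Lφ u φ t - (ContinuousLinearMap.adjoint (P.fφ u φ t)) (η t)

open Classical in
/-- The right-continuous `η` solves the adjoint equation `η' = L_φ - f_φᵀ η` between observation
times, satisfies the reset condition `η(t⁻) = η(t⁺) + ∑ ∇Fₖ(φ(t))`, summed over the observations
`k` with `tₖ = t`, and vanishes after the last observation at the final time: `η(T⁺) = 0`. -/
def IsAdjointSolution (u : Signal N) (φ η : Signal l) : Prop :=
  (∀ a b, 0 ≤ a → a ≤ b → b ≤ P.T → (∀ k, P.obs k ∉ Ioc a b) →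
    IntervalIntegrable (P.adjointRhs u φ η) volume a b ∧
      η b = η a + ∫ s in a..b, P.adjointRhs u φ η s) ∧
  (∀ t ∈ Ioc 0 P.T, Tendsto η (𝓝[<] t)
    (𝓝 (η t + ∑ k, if P.obs k = t then gradient (P.F k) (φ t) else 0))) ∧
  η P.T = 0

/-- The Euclidean (`L²`) inner product of controls. -/
def euclideanMetric (v w : Signal N) : ℝ :=
  ∫ t in (0 : ℝ)..P.T, inner ℝ (v t) (w t)

/-- The path-wise Fisher information `G(u)[v, w] = ∫₀ᵀ v(t)ᵀ g(φ(t)) w(t) dt`, where `φ` are the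
moments belonging to `u`. -/
def fisherMetric (φ : Signal l) (v w : Signal N) : ℝ :=
  ∫ t in (0 : ℝ)..P.T, inner ℝ (v t) (matVec (P.g (φ t)) (w t))

/-- `g(φ) u - f_uᵀ η`. -/
def regularGradient (u : Signal N) (φ η : Signal l) : Signal N := fun t =>
  matVec (P.g (φ t)) (u t) - (ContinuousLinearMap.adjoint (P.fu u φ t)) (η t)

/-- `u - g(φ)⁻¹ f_uᵀ η`. -/
def naturalGradient (u : Signal N) (φ η : Signal l) : Signal N := fun t =>
  u t - matVec (P.g (φ t))⁻¹ ((ContinuousLinearMap.adjoint (P.fu u φ t)) (η t))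

end ControlProblem

end

/-! The control is essentially bounded and the trajectory stays in a compact part of `Ω`, so along
it all coefficients are essentially bounded and `f` is Lipschitz; Grönwall gives uniqueness. For a
perturbed control, `f` is replaced by a globally Lipschitz extension from a compact neighbourhood of
the trajectory. A contraction solves the extended equation on all of `[0, T]`, and Grönwall gives
`‖ψ - φ‖ ≤ C|s|`. For small `s` this keeps `ψ` where the extension agrees with `f`
(`exists_perturbation`).

Subtracting from `η` the step function `laterJumps` of the jumps still to come leaves a continuous
function. The adjoint problem thereby becomes one linear backward integral equation, solved and
shown unique by the same two tools.

For the derivative no linearised state equation is needed. Fubini, applied to the integral equations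
of `η` and of `ψ - φ`, rewrites the first-order observation terms (`sum_inner_gradient_eq`). In `J[u
+ sv] - J[u]` all terms linear in `ψ - φ` then cancel, because `η` solves the adjoint equation. What
remains is `s ∫ ⟨g u - f_uᵀ η, v⟩` plus Taylor remainders of `L`, `f` and `Fₖ` (`objective_sub_eq`),
which are `o(s)` by the Lipschitz bound on `ψ - φ`.

If `δJ[u, v] = G(r, v)`, stationarity of the Lagrangian reads `G(u' - u + h r, v) = 0` for all `v`.
Semidefiniteness of `G` makes such a `u'` a minimiser, and pointwise definiteness gives `u' = u - h
r` almost everywhere. The Euclidean and the Fisher metric differ only in the representative `r`. -/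

/-! ### Grönwall, Carathéodory equations and compactness tools -/

/-- Integral form of Grönwall's inequality. -/
theorem le_mul_exp_of_le_add_integral {w : ℝ → ℝ} {T c L : ℝ} (hL : 0 ≤ L)
    (hw : ContinuousOn w (Icc 0 T))
    (h : ∀ t ∈ Icc 0 T, w t ≤ c + L * ∫ s in (0 : ℝ)..t, w s) :
    ∀ t ∈ Icc 0 T, w t ≤ c * Real.exp (L * t) := by
  intro t ht
  have hT : 0 ≤ T := ht.1.trans ht.2
  -- Extending `w` by its end values makes the primitive `H` differentiable everywhere, so the
  -- differential form of Grönwall applies to `H`, which dominates `w`.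
  set W : ℝ → ℝ := IccExtend hT ((Icc 0 T).domRestrict w) with hW
  have hWc : Continuous W := hw.domRestrict.Icc_extend'
  have hWw : ∀ s ∈ Icc 0 T, W s = w s := fun s hs => by
    rw [hW, IccExtend_of_mem _ _ hs]; rfl
  have hint : ∀ s ∈ Icc 0 T, ∫ r in (0 : ℝ)..s, w r = ∫ r in (0 : ℝ)..s, W r := fun s hs =>
    intervalIntegral.integral_congr fun r hr => by
      rw [uIcc_of_le hs.1] at hr
      exact (hWw r ⟨hr.1, hr.2.trans hs.2⟩).symm
  set H : ℝ → ℝ := fun s => c + L * ∫ r in (0 : ℝ)..s, W r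
  have hH : ∀ s, HasDerivAt H (L * W s) s := fun s =>
    ((hWc.integral_hasStrictDerivAt 0 s).hasDerivAt.const_mul L).const_add c
  have key : ∀ x ∈ Icc 0 T, H x ≤ gronwallBound c L 0 (x - 0) := by
    refine le_gronwallBound_of_liminf_deriv_right_le (f' := fun s => L * W s)
      (fun s _ => (hH s).continuousAt.continuousWithinAt) (fun x _ r hr => ?_) ?_ ?_
    · exact (hH x).hasDerivWithinAt.liminf_right_slope_le hr
    · simp [H]
    · intro x hx
      have hx' := Ico_subset_Icc_self hx
      rw [add_zero, hWw x hx']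
      refine mul_le_mul_of_nonneg_left ?_ hL
      have := h x hx'
      rwa [hint x hx'] at this
  have h1 := key t ht
  rw [gronwallBound_ε0, sub_zero] at h1
  refine le_trans ?_ h1
  have := h t ht
  rwa [hint t ht] at this

theorem MeasureTheory.IntegrableOn.intervalIntegrable_of_mem_Icc {E : Type*} [NormedAddCommGroup E] {f : ℝ → E}
    {a b s t : ℝ} (hf : IntegrableOn f (Icc a b)) (hs : s ∈ Icc a b) (ht : t ∈ Icc a b) :
    IntervalIntegrable f volume s t :=
  (hf.mono_set ((convex_Icc a b).ordConnected.uIcc_subset hs ht)).intervalIntegrable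

theorem MeasureTheory.IntegrableOn.continuousOn_primitive_Icc {E : Type*} [NormedAddCommGroup E]
    [NormedSpace ℝ E] {f : ℝ → E} {a b : ℝ} (hf : IntegrableOn f (Icc a b)) :
    ContinuousOn (fun t => ∫ s in a..t, f s) (Icc a b) := by
  rcases le_or_gt a b with hab | hab
  · have := intervalIntegral.continuousOn_primitive_interval (μ := volume) (f := f) (a := a)
      (b := b) (by rwa [uIcc_of_le hab])
    rwa [uIcc_of_le hab] at this
  · simp [Icc_eq_empty_of_lt hab]

/-- Global existence for a Carathéodory differential equation with Lipschitz right-hand side. -/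
theorem exists_forall_eq_add_integral {E : Type*} [NormedAddCommGroup E] [NormedSpace ℝ E]
    [CompleteSpace E] {T : ℝ} (hT : 0 ≤ T) (F : ℝ → E → E) (L : NNReal) (x₀ : E)
    (hint : ∀ ψ : ℝ → E, Continuous ψ → IntegrableOn (fun t => F t (ψ t)) (Icc 0 T))
    (hLip : ∀ᵐ t ∂volume.restrict (Icc 0 T), LipschitzWith L (F t)) :
    ∃ ψ : ℝ → E, Continuous ψ ∧ ∀ t ∈ Icc 0 T, ψ t = x₀ + ∫ s in (0 : ℝ)..t, F s (ψ s) := by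
  -- Exponentially weighted norm: solutions are written as `exp(c t) z(t)`. In the sup norm of `z`
  -- the Picard map has Lipschitz constant `L / c = L / (L + 1) < 1` whatever `T` is, so one
  -- contraction covers the whole horizon.
  set c : ℝ := L + 1 with hc
  have hc0 : 0 < c := by positivity
  let lift : C(Icc (0 : ℝ) T, E) → ℝ → E := fun z s => Real.exp (c * s) • IccExtend hT z s
  have hlift : ∀ z, Continuous (lift z) := fun z =>
    (by fun_prop : Continuous fun s : ℝ => Real.exp (c * s)).smul z.continuous.Icc_extend'
  let I : C(Icc (0 : ℝ) T, E) → ℝ → E := fun z t => ∫ s in (0 : ℝ)..t, F s (lift z s)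
  have hI : ∀ z, ContinuousOn (I z) (Icc 0 T) := fun z =>
    (hint _ (hlift z)).continuousOn_primitive_Icc
  let Φ : C(Icc (0 : ℝ) T, E) → C(Icc (0 : ℝ) T, E) := fun z =>
    { toFun := fun t => Real.exp (-(c * t)) • (x₀ + I z t)
      continuous_toFun := by
        refine Continuous.smul (by fun_prop) (continuous_const.add ?_)
        exact (hI z).domRestrict }
  have hΦ : ContractingWith (L / (L + 1)) Φ := by
    refine ⟨?_, LipschitzWith.of_dist_le_mul fun z z' => ?_⟩
    · rw [div_lt_one (by positivity)]; exact lt_add_one L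
    · refine (ContinuousMap.dist_le (by positivity)).2 fun t => ?_
      have ht := t.2
      change dist (Real.exp (-(c * t)) • (x₀ + I z t)) (Real.exp (-(c * t)) • (x₀ + I z' t)) ≤ _
      rw [dist_eq_norm, ← smul_sub, add_sub_add_left_eq_sub, norm_smul, Real.norm_eq_abs,
        abs_of_pos (Real.exp_pos _)]
      have h0 : (0 : ℝ) ∈ Icc 0 T := ⟨le_rfl, hT⟩
      have hsub : I z t - I z' t = ∫ s in (0 : ℝ)..t, (F s (lift z s) - F s (lift z' s)) :=
        (intervalIntegral.integral_sub
          ((hint _ (hlift z)).intervalIntegrable_of_mem_Icc h0 ht)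
          ((hint _ (hlift z')).intervalIntegrable_of_mem_Icc h0 ht)).symm
      have hbound : ‖I z t - I z' t‖ ≤ ∫ s in (0 : ℝ)..t, L * dist z z' * Real.exp (c * s) := by
        rw [hsub]
        refine intervalIntegral.norm_integral_le_of_norm_le ht.1 ?_
          (Continuous.intervalIntegrable (by fun_prop) _ _)
        have hL' := (ae_restrict_iff' measurableSet_Icc).1 hLip
        filter_upwards [hL'] with s hs hst
        have h1 := (hs ⟨hst.1.le, hst.2.trans ht.2⟩).dist_le_mul (lift z s) (lift z' s)
        rw [dist_eq_norm] at h1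
        refine h1.trans ?_
        rw [mul_assoc]
        refine mul_le_mul_of_nonneg_left ?_ L.2
        rw [dist_eq_norm, ← smul_sub, norm_smul, Real.norm_eq_abs, abs_of_pos (Real.exp_pos _),
          mul_comm, ← dist_eq_norm]
        exact mul_le_mul_of_nonneg_right (ContinuousMap.dist_apply_le_dist _) (Real.exp_pos _).le
      have hexp : ∫ s in (0 : ℝ)..t, Real.exp (c * s) = (Real.exp (c * t) - 1) / c := by
        rw [intervalIntegral.integral_comp_mul_left (fun x => Real.exp x) hc0.ne', integral_exp]
        simp [div_eq_inv_mul]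
      rw [intervalIntegral.integral_const_mul, hexp] at hbound
      calc Real.exp (-(c * t)) * ‖I z t - I z' t‖
          ≤ Real.exp (-(c * t)) * (L * dist z z' * ((Real.exp (c * t) - 1) / c)) := by gcongr
        _ = (L / c * dist z z') * (1 - Real.exp (-(c * t))) := by
          rw [Real.exp_neg]
          have := (Real.exp_pos (c * t)).ne'
          field_simp
        _ ≤ (L / c * dist z z') * 1 := by
          refine mul_le_mul_of_nonneg_left ?_ (by positivity)
          linarith [Real.exp_pos (-(c * t))]
        _ = _ := by simp [hc]
  obtain ⟨z, hz, -⟩ := hΦ.exists_fixedPoint 0 (edist_ne_top _ _)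
  refine ⟨lift z, hlift z, fun t ht => ?_⟩
  have h1 : Φ z ⟨t, ht⟩ = z ⟨t, ht⟩ := by rw [hz]
  change Real.exp (-(c * t)) • (x₀ + I z t) = _ at h1
  change Real.exp (c * t) • IccExtend hT z t = _
  rw [IccExtend_of_mem _ _ ht, ← h1, smul_smul, ← Real.exp_add, add_neg_cancel, Real.exp_zero,
    one_smul]

/-- A continuous function of a measurable function with values in a compact set is essentially
bounded. -/
theorem memLp_top_comp_of_mem_isCompact {α X Y : Type*} [MeasurableSpace α] {μ : Measure α}
    [IsFiniteMeasure μ] [PseudoMetricSpace X] [T2Space X] [SecondCountableTopology X]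
    [MeasurableSpace X] [BorelSpace X] [NormedAddCommGroup Y] {H : X → Y} {p : α → X} {K : Set X}
    (hK : IsCompact K) (hH : ContinuousOn H K) (hp : AEMeasurable p μ) (hpK : ∀ᵐ t ∂μ, p t ∈ K) :
    MemLp (fun t => H (p t)) ⊤ μ := by
  obtain ⟨C, hC⟩ := hK.exists_bound_of_continuousOn hH
  have hKm : MeasurableSet K := hK.isClosed.measurableSet
  -- `H` is only controlled on `K`, but the law of `p` is carried by `K`, and there continuity
  -- yields measurability.
  have hres : (μ.map p).restrict K = μ.map p :=
    Measure.restrict_eq_self_of_ae_mem ((ae_map_iff hp hKm).2 hpK)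
  have hm : AEStronglyMeasurable H (μ.map p) := by
    rw [← hres]
    exact hH.aestronglyMeasurable_of_isCompact hK hKm
  exact memLp_top_of_bound (hm.comp_aemeasurable hp) C (hpK.mono fun t ht => hC _ ht)

/-- `K` need not be convex: a `C¹` function is locally Lipschitz, and compactness makes the constant
uniform. -/
theorem ContDiffOn.exists_lipschitzOnWith_of_isCompact {E F : Type*} [NormedAddCommGroup E]
    [NormedSpace ℝ E] [NormedAddCommGroup F] [NormedSpace ℝ F] {H : E → F} {U K : Set E}
    (hH : ContDiffOn ℝ 1 H U) (hU : IsOpen U) (hK : IsCompact K) (hKU : K ⊆ U) :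
    ∃ C, LipschitzOnWith C H K := by
  refine LocallyLipschitzOn.exists_lipschitzOnWith_of_compact hK fun x hx => ?_
  obtain ⟨C, t, ht, hC⟩ := (hH.contDiffAt (hU.mem_nhds (hKU hx))).exists_lipschitzOnWith
  exact ⟨C, t, mem_nhdsWithin_of_mem_nhds ht, hC⟩

/-- The first order Taylor expansion of a `C¹` function is uniform on compact sets. -/
theorem ContDiffOn.exists_norm_sub_sub_le {E F : Type*} [NormedAddCommGroup E]
    [NormedSpace ℝ E] [NormedAddCommGroup F] [NormedSpace ℝ F] {H : E → F} {U K : Set E}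
    (hH : ContDiffOn ℝ 1 H U) (hU : IsOpen U) (hK : IsCompact K) (hKU : K ⊆ U) {ε : ℝ}
    (hε : 0 < ε) :
    ∃ δ > 0, ∀ p ∈ K, ∀ q, ‖q - p‖ < δ →
      ‖H q - H p - fderiv ℝ H p (q - p)‖ ≤ ε * ‖q - p‖ := by
  have hcont : ∀ p ∈ U, ContinuousAt (fderiv ℝ H) p := fun p hp =>
    (hH.continuousOn_fderiv_of_isOpen hU le_rfl).continuousAt (hU.mem_nhds hp)
  have hunif := hK.uniformContinuousAt_of_continuousAt (fderiv ℝ H)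
    (fun p hp => hcont p (hKU hp)) (Metric.dist_mem_uniformity hε)
  obtain ⟨δ₁, hδ₁, h₁⟩ := Metric.mem_uniformity_dist.1 hunif
  obtain ⟨δ₂, hδ₂, h₂⟩ := hK.exists_cthickening_subset_open hU hKU
  refine ⟨min δ₁ δ₂, lt_min hδ₁ hδ₂, fun p hp q hq => ?_⟩
  -- Inside this ball the segment from `p` to `q` lies in `U`, and the derivative differs from that
  -- at `p` by at most `ε`; the mean value inequality for `H` minus its linearisation at `p`
  -- concludes.
  have hball : Metric.ball p (min δ₁ δ₂) ⊆ U := fun x hx => h₂ <|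
    Metric.mem_cthickening_of_dist_le x p δ₂ K hp
      ((Metric.mem_ball.1 hx).le.trans (min_le_right _ _))
  refine (convex_ball p (min δ₁ δ₂)).norm_image_sub_le_of_norm_hasFDerivWithin_le'
    (f' := fun x => fderiv ℝ H x) (fun x hx => ?_) (fun x hx => ?_)
    (Metric.mem_ball_self (lt_min hδ₁ hδ₂)) (mem_ball_iff_norm.2 hq)
  · exact ((hH.contDiffAt (hU.mem_nhds (hball hx))).differentiableAt
      one_ne_zero).hasFDerivAt.hasFDerivWithinAt
  · have := h₁ (a := p) (b := x)
      (by rw [dist_comm]; exact (Metric.mem_ball.1 hx).trans_le (min_le_left _ _)) hp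
    rw [← dist_eq_norm, dist_comm]
    exact this.le

/-- Integration by parts for primitives of integrable functions. -/
theorem integral_inner_integral_eq {E : Type*} [NormedAddCommGroup E] [InnerProductSpace ℝ E]
    [CompleteSpace E] {T : ℝ} (hT : 0 ≤ T) {a b : ℝ → E} (ha : IntegrableOn a (Icc 0 T))
    (hb : IntegrableOn b (Icc 0 T)) :
    ∫ t in (0 : ℝ)..T, inner ℝ (∫ s in t..T, a s) (b t)
      = ∫ t in (0 : ℝ)..T, inner ℝ (a t) (∫ s in (0 : ℝ)..t, b s) := by
  set μ := volume.restrict (Icc (0 : ℝ) T) with hμ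
  set k : ℝ → ℝ → ℝ := fun t s =>
    {q : ℝ × ℝ | q.1 ≤ q.2}.indicator (fun q => inner ℝ (a q.2) (b q.1)) (t, s) with hk
  have hkint : Integrable (Function.uncurry k) (μ.prod μ) := by
    refine Integrable.indicator ?_ (measurableSet_le measurable_fst measurable_snd)
    have := (Integrable.op_fst_snd (μ := μ) (ν := μ) (op := fun x y : E => inner ℝ y x)
      (f := b) (g := a) (by fun_prop) ⟨1, fun x y => by
        rw [one_mul, mul_comm]; exact norm_inner_le_norm y x⟩ hb ha)
    exact this
  have h1 : ∀ t ∈ Icc 0 T, inner ℝ (∫ s in t..T, a s) (b t) = ∫ s, k t s ∂μ := by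
    intro t ht
    rw [intervalIntegral.integral_of_le ht.2, ← integral_Icc_eq_integral_Ioc, real_inner_comm,
      ← integral_inner (ha.mono_set (Icc_subset_Icc_left ht.1))]
    have : ∀ s, k t s = (Ici t).indicator (fun s => inner ℝ (b t) (a s)) s := fun s => by
      by_cases h : t ≤ s <;> simp [hk, indicator, h, real_inner_comm]
    simp_rw [this]
    rw [integral_indicator measurableSet_Ici, hμ, Measure.restrict_restrict measurableSet_Ici]
    congr 2
    ext s; constructor
    · exact fun h => ⟨h.1, ht.1.trans h.1, h.2⟩
    · exact fun h => ⟨h.1, h.2.2⟩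
  have h2 : ∀ s ∈ Icc 0 T, inner ℝ (a s) (∫ t in (0 : ℝ)..s, b t) = ∫ t, k t s ∂μ := by
    intro s hs
    rw [intervalIntegral.integral_of_le hs.1, ← integral_Icc_eq_integral_Ioc,
      ← integral_inner (hb.mono_set (Icc_subset_Icc_right hs.2))]
    have : ∀ t, k t s = (Iic s).indicator (fun t => inner ℝ (a s) (b t)) t := fun t => by
      by_cases h : t ≤ s <;> simp [hk, indicator, h]
    simp_rw [this]
    rw [integral_indicator measurableSet_Iic, hμ, Measure.restrict_restrict measurableSet_Iic]
    congr 2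
    ext t; constructor
    · exact fun h => ⟨h.2, h.1, h.2.trans hs.2⟩
    · exact fun h => ⟨h.2.1, h.1⟩
  rw [intervalIntegral.integral_of_le hT, intervalIntegral.integral_of_le hT,
    ← integral_Icc_eq_integral_Ioc, ← integral_Icc_eq_integral_Ioc,
    setIntegral_congr_fun measurableSet_Icc h1, setIntegral_congr_fun measurableSet_Icc h2]
  exact integral_integral_swap hkint

theorem norm_integral_le_of_ae_restrict_Icc {E : Type*} [NormedAddCommGroup E] [NormedSpace ℝ E]
    {f : ℝ → E} {g : ℝ → ℝ} {T t : ℝ} (ht : t ∈ Icc 0 T)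
    (h : ∀ᵐ s ∂volume.restrict (Icc 0 T), ‖f s‖ ≤ g s) (hg : IntegrableOn g (Icc 0 T)) :
    ‖∫ s in (0 : ℝ)..t, f s‖ ≤ ∫ s in (0 : ℝ)..t, g s := by
  refine intervalIntegral.norm_integral_le_of_norm_le ht.1 ?_
    (hg.intervalIntegrable_of_mem_Icc ⟨le_rfl, ht.1.trans ht.2⟩ ht)
  filter_upwards [(ae_restrict_iff' measurableSet_Icc).1 h] with s hs hst
  exact hs ⟨hst.1.le, hst.2.trans ht.2⟩

theorem integral_congr_of_ae_restrict_Icc {E : Type*} [NormedAddCommGroup E] [NormedSpace ℝ E]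
    {f g : ℝ → E} {T a b : ℝ} (ha : a ∈ Icc 0 T) (hb : b ∈ Icc 0 T)
    (h : ∀ᵐ s ∂volume.restrict (Icc 0 T), f s = g s) :
    ∫ s in a..b, f s = ∫ s in a..b, g s := by
  refine intervalIntegral.integral_congr_ae ?_
  filter_upwards [(ae_restrict_iff' measurableSet_Icc).1 h] with s hs hst
  exact hs ((convex_Icc 0 T).ordConnected.uIcc_subset ha hb (uIoc_subset_uIcc hst))

/-! ### Bounded signals and the forward equation -/

namespace ControlProblem

variable {N l K : ℕ} (P : ControlProblem N l K)

instance : IsFiniteMeasure P.timeMeasure :=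
  ⟨by simp [timeMeasure]⟩

theorem zero_mem : (0 : ℝ) ∈ Icc 0 P.T := ⟨le_rfl, P.T_pos.le⟩

theorem T_mem : P.T ∈ Icc 0 P.T := ⟨P.T_pos.le, le_rfl⟩

theorem ae_mem_Icc : ∀ᵐ t ∂P.timeMeasure, t ∈ Icc 0 P.T :=
  ae_restrict_mem measurableSet_Icc

variable {P}

theorem integrableOn_of_memLp {E : Type*} [NormedAddCommGroup E] {f : ℝ → E}
    (hf : MemLp f ⊤ P.timeMeasure) : IntegrableOn f (Icc 0 P.T) :=
  hf.integrable le_top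

theorem exists_ae_norm_le {E : Type*} [NormedAddCommGroup E] {f : ℝ → E}
    (hf : MemLp f ⊤ P.timeMeasure) : ∃ R, 0 ≤ R ∧ ∀ᵐ t ∂P.timeMeasure, ‖f t‖ ≤ R := by
  have h := hf.2
  rw [eLpNorm_exponent_top] at h
  refine ⟨_, ENNReal.toReal_nonneg (a := eLpNormEssSup f P.timeMeasure), ?_⟩
  filter_upwards [ae_le_eLpNormEssSup (f := f) (μ := P.timeMeasure)] with t ht
  have := ENNReal.toReal_mono h.ne ht
  simpa using this

theorem memLp_of_continuousOn {E : Type*} [NormedAddCommGroup E] {f : ℝ → E}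
    (hf : ContinuousOn f (Icc 0 P.T)) : MemLp f ⊤ P.timeMeasure := by
  refine memLp_top_comp_of_mem_isCompact (H := f) (p := fun t => t) isCompact_Icc hf
    aemeasurable_id P.ae_mem_Icc

/-- Continuous functions of a control, of a path in `Ω` and of a further bounded signal are
essentially bounded. -/
theorem memLp_comp_prod {d : ℕ} {Y : Type*} [NormedAddCommGroup Y] {u : Signal N} {φ : Signal l}
    {η : Signal d} (hu : u ∈ P.controls) (hφ : ContinuousOn φ (Icc 0 P.T))
    {U : Set (EuclideanSpace ℝ (Fin l))} (hφU : ∀ t ∈ Icc 0 P.T, φ t ∈ U)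
    (hη : MemLp η ⊤ P.timeMeasure)
    {H : (EuclideanSpace ℝ (Fin N) × EuclideanSpace ℝ (Fin l)) × EuclideanSpace ℝ (Fin d) → Y}
    (hH : ContinuousOn H ((univ ×ˢ U) ×ˢ univ)) :
    MemLp (fun t => H ((u t, φ t), η t)) ⊤ P.timeMeasure := by
  obtain ⟨R, -, hR⟩ := exists_ae_norm_le hu
  obtain ⟨R', -, hR'⟩ := exists_ae_norm_le hη
  have hu' : AEMeasurable u P.timeMeasure := hu.1.aemeasurable
  have hη' : AEMeasurable η P.timeMeasure := hη.1.aemeasurable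
  have hφ' : AEMeasurable φ P.timeMeasure := hφ.aemeasurable measurableSet_Icc
  refine memLp_top_comp_of_mem_isCompact (p := fun t => ((u t, φ t), η t))
    (K := (Metric.closedBall 0 R ×ˢ (φ '' Icc 0 P.T)) ×ˢ Metric.closedBall 0 R')
    (((isCompact_closedBall _ _).prod (isCompact_Icc.image_of_continuousOn hφ)).prod
      (isCompact_closedBall _ _)) (hH.mono ?_) ((hu'.prodMk hφ').prodMk hη') ?_
  · rintro ⟨⟨w, x⟩, y⟩ ⟨⟨-, t, ht, rfl⟩, -⟩
    exact ⟨⟨trivial, hφU t ht⟩, trivial⟩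
  · filter_upwards [hR, hR', P.ae_mem_Icc] with t h1 h2 h3
    exact ⟨⟨mem_closedBall_zero_iff.2 h1, t, h3, rfl⟩, mem_closedBall_zero_iff.2 h2⟩

theorem memLp_comp {Y : Type*} [NormedAddCommGroup Y] {u : Signal N} {φ : Signal l}
    (hu : u ∈ P.controls) (hφ : ContinuousOn φ (Icc 0 P.T))
    {U : Set (EuclideanSpace ℝ (Fin l))} (hφU : ∀ t ∈ Icc 0 P.T, φ t ∈ U)
    {H : EuclideanSpace ℝ (Fin N) × EuclideanSpace ℝ (Fin l) → Y}
    (hH : ContinuousOn H (univ ×ˢ U)) :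
    MemLp (fun t => H (u t, φ t)) ⊤ P.timeMeasure :=
  -- The third signal is the trivial one in the zero-dimensional space.
  memLp_comp_prod (d := 0) (η := 0) (H := fun q => H q.1) hu hφ hφU MemLp.zero
    (hH.comp continuousOn_fst fun _ hq => hq.1)

theorem add_smul_mem_controls {u v : Signal N} (hu : u ∈ P.controls) (hv : v ∈ P.controls)
    (s : ℝ) : u + s • v ∈ P.controls :=
  MemLp.add hu (MemLp.const_smul hv s)

theorem isOpen_univ_prod : IsOpen ((univ : Set (EuclideanSpace ℝ (Fin N))) ×ˢ P.Ω) :=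
  isOpen_univ.prod P.isOpen_Ω

namespace IsForwardSolution

variable {u : Signal N} {φ ψ : Signal l}

theorem memLp_f (hφ : P.IsForwardSolution u φ) (hu : u ∈ P.controls) :
    MemLp (fun t => P.f (u t) (φ t)) ⊤ P.timeMeasure :=
  memLp_comp hu hφ.1 hφ.2.1 P.contDiffOn_f.continuousOn

theorem isCompact_image (hφ : P.IsForwardSolution u φ) : IsCompact (φ '' Icc 0 P.T) :=
  isCompact_Icc.image_of_continuousOn hφ.1

theorem image_subset (hφ : P.IsForwardSolution u φ) : φ '' Icc 0 P.T ⊆ P.Ω :=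
  image_subset_iff.2 hφ.2.1

theorem sub_eq_integral {w : Signal N} (hφ : P.IsForwardSolution u φ) (hu : u ∈ P.controls)
    (hψ : P.IsForwardSolution w ψ) (hw : w ∈ P.controls) {t : ℝ} (ht : t ∈ Icc 0 P.T) :
    ψ t - φ t = ∫ s in (0 : ℝ)..t, (P.f (w s) (ψ s) - P.f (u s) (φ s)) := by
  rw [hφ.2.2 t ht, hψ.2.2 t ht, add_sub_add_left_eq_sub, intervalIntegral.integral_sub
    ((integrableOn_of_memLp (hψ.memLp_f hw)).intervalIntegrable_of_mem_Icc P.zero_mem ht)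
    ((integrableOn_of_memLp (hφ.memLp_f hu)).intervalIntegrable_of_mem_Icc P.zero_mem ht)]

/-- Solutions of the forward equation are unique. -/
theorem eqOn (hφ : P.IsForwardSolution u φ) (hψ : P.IsForwardSolution u ψ)
    (hu : u ∈ P.controls) : EqOn ψ φ (Icc 0 P.T) := by
  obtain ⟨R, -, hR⟩ := exists_ae_norm_le hu
  -- One Lipschitz constant serves both trajectories, since the union of their images is compact in
  -- `Ω`.
  obtain ⟨C, hC⟩ := P.contDiffOn_f.exists_lipschitzOnWith_of_isCompact isOpen_univ_prod
    ((isCompact_closedBall 0 R).prod (hφ.isCompact_image.union hψ.isCompact_image))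
    (prod_mono (subset_univ _) (union_subset hφ.image_subset hψ.image_subset))
  have hcont : ContinuousOn (fun t => ‖ψ t - φ t‖) (Icc 0 P.T) := (hψ.1.sub hφ.1).norm
  intro t ht
  have key := le_mul_exp_of_le_add_integral (c := 0) C.2 hcont (fun t ht => ?_) t ht
  · rw [zero_mul] at key
    exact sub_eq_zero.1 (norm_le_zero_iff.1 key)
  · rw [zero_add, hφ.sub_eq_integral hu hψ hu ht, ← intervalIntegral.integral_const_mul]
    refine norm_integral_le_of_ae_restrict_Icc ht ?_
      ((hcont.const_mul _).integrableOn_Icc)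
    filter_upwards [hR, P.ae_mem_Icc] with s hs hsT
    have := hC.dist_le_mul (u s, ψ s) ⟨mem_closedBall_zero_iff.2 hs, Or.inr ⟨s, hsT, rfl⟩⟩
      (u s, φ s) ⟨mem_closedBall_zero_iff.2 hs, Or.inl ⟨s, hsT, rfl⟩⟩
    simpa [dist_eq_norm, Prod.norm_def] using this

/-- The chosen solution agrees with `φ` on `[0, T]` by uniqueness, and the objective reads nothing
outside. -/
theorem reducedObjective_eq (hφ : P.IsForwardSolution u φ) (hu : u ∈ P.controls) :
    P.reducedObjective u = P.objective u φ := by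
  have h : ∃ φ, P.IsForwardSolution u φ := ⟨φ, hφ⟩
  have heq : EqOn h.choose φ (Icc 0 P.T) := hφ.eqOn h.choose_spec hu
  rw [reducedObjective, dif_pos h, objective, objective]
  congr 1
  · refine intervalIntegral.integral_congr fun t ht => ?_
    rw [uIcc_of_le P.T_pos.le] at ht
    simp only [heq ht]
  · exact Finset.sum_congr rfl fun k _ => by rw [heq (P.obs_mem k)]

/-- Small perturbations of the control are admissible, and the solution depends on them in a
Lipschitz continuous way. -/
theorem exists_perturbation {v : Signal N} (hφ : P.IsForwardSolution u φ) (hu : u ∈ P.controls)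
    (hv : v ∈ P.controls) :
    ∃ C : ℝ, 0 ≤ C ∧ ∀ᶠ s : ℝ in 𝓝 0, ∃ ψ, P.IsForwardSolution (u + s • v) ψ ∧
      ∀ t ∈ Icc 0 P.T, ‖ψ t - φ t‖ ≤ C * |s| := by
  obtain ⟨R, hR0, hR⟩ := exists_ae_norm_le hu
  obtain ⟨R', hR'0, hR'⟩ := exists_ae_norm_le hv
  -- The closed `δ`-neighbourhood `κ` of the trajectory is compact and lies in `Ω`. The Lipschitz
  -- function `f` on a ball times `κ` is extended to a global `F`; the solution for `F` will turn
  -- out not to leave `κ`.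
  obtain ⟨δ, hδ, hδΩ⟩ := hφ.isCompact_image.exists_cthickening_subset_open P.isOpen_Ω
    hφ.image_subset
  set κ := Metric.cthickening δ (φ '' Icc 0 P.T) with hκ
  have hφκ : ∀ t ∈ Icc 0 P.T, φ t ∈ κ := fun t ht =>
    Metric.self_subset_cthickening _ ⟨t, ht, rfl⟩
  obtain ⟨C₀, hC₀⟩ := P.contDiffOn_f.exists_lipschitzOnWith_of_isCompact isOpen_univ_prod
    ((isCompact_closedBall 0 (R + R')).prod (hφ.isCompact_image.cthickening (r := δ)))
    (prod_mono (subset_univ _) hδΩ)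
  obtain ⟨F, hF, hFf⟩ := hC₀.extend_finite_dimension
  set C₁ := lipschitzExtensionConstant (EuclideanSpace ℝ (Fin l)) * C₀ with hC₁
  -- Grönwall constant: the perturbation `s v` contributes at most `C₁ |s| R'` to the right-hand
  -- side, hence `C₁ |s| R' T` after integration.
  set C : ℝ := C₁ * R' * P.T * Real.exp (C₁ * P.T) with hC
  have hT := P.T_pos
  have hC_nonneg : 0 ≤ C := by positivity
  refine ⟨C, hC_nonneg, ?_⟩
  -- This keeps `u + s v` in the ball of radius `R + R'`, where `F = f`; the second condition keeps
  -- `ψ` in `κ`.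
  have hs1 : ∀ᶠ s : ℝ in 𝓝 0, |s| < 1 :=
    continuous_abs.continuousAt.eventually_lt continuousAt_const (by simp)
  have hs2 : ∀ᶠ s : ℝ in 𝓝 0, C * |s| < δ :=
    (continuous_const.mul continuous_abs).continuousAt.eventually_lt continuousAt_const
      (by simpa using hδ)
  filter_upwards [hs1, hs2] with s hs1 hs2
  have hw := add_smul_mem_controls hu hv s
  have hwR : ∀ᵐ t ∂P.timeMeasure, ‖(u + s • v) t‖ ≤ R + R' := by
    filter_upwards [hR, hR'] with t h1 h2
    refine (norm_add_le _ _).trans (add_le_add h1 ?_)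
    rw [Pi.smul_apply, norm_smul, Real.norm_eq_abs]
    exact (mul_le_of_le_one_left (norm_nonneg _) hs1.le).trans h2
  have hFint : ∀ ψ : Signal l, ContinuousOn ψ (Icc 0 P.T) →
      IntegrableOn (fun t => F ((u + s • v) t, ψ t)) (Icc 0 P.T) := fun ψ hψ =>
    integrableOn_of_memLp (memLp_comp (U := univ) hw hψ (fun _ _ => trivial)
      hF.continuous.continuousOn)
  obtain ⟨ψ, hψc, hψ⟩ := exists_forall_eq_add_integral P.T_pos.le
    (fun t x => F ((u + s • v) t, x)) C₁ P.φ₀ (fun ψ hψ => hFint ψ hψ.continuousOn)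
    (Eventually.of_forall fun t => LipschitzWith.of_dist_le_mul fun x y => by
      simpa [dist_eq_norm, Prod.norm_def] using hF.dist_le_mul ((u + s • v) t, x)
        ((u + s • v) t, y))
  have hcont : ContinuousOn (fun t => ‖ψ t - φ t‖) (Icc 0 P.T) :=
    (hψc.continuousOn.sub hφ.1).norm
  have hclose : ∀ t ∈ Icc 0 P.T, ‖ψ t - φ t‖ ≤ C * |s| := by
    intro t ht
    have key := le_mul_exp_of_le_add_integral (c := C₁ * (|s| * R') * P.T) C₁.2 hcont
      (fun t ht => ?_) t ht
    · refine key.trans ?_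
      calc C₁ * (|s| * R') * P.T * Real.exp (C₁ * t)
          ≤ C₁ * (|s| * R') * P.T * Real.exp (C₁ * P.T) := by gcongr; exact ht.2
        _ = C * |s| := by rw [hC]; ring
    · have h1 : ψ t - φ t = ∫ r in (0 : ℝ)..t,
          (F ((u + s • v) r, ψ r) - P.f (u r) (φ r)) := by
        rw [hφ.2.2 t ht, hψ t ht, add_sub_add_left_eq_sub, intervalIntegral.integral_sub
          ((hFint ψ hψc.continuousOn).intervalIntegrable_of_mem_Icc P.zero_mem ht)
          ((integrableOn_of_memLp (hφ.memLp_f hu)).intervalIntegrable_of_mem_Icc P.zero_mem ht)]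
      have h2 : ‖ψ t - φ t‖ ≤ ∫ r in (0 : ℝ)..t, (C₁ * (|s| * R') + C₁ * ‖ψ r - φ r‖) := by
        rw [h1]
        refine norm_integral_le_of_ae_restrict_Icc ht ?_
          ((continuousOn_const.add (hcont.const_mul _)).integrableOn_Icc)
        filter_upwards [hR, hR', P.ae_mem_Icc] with r h1 h2 hr
        have hmem : (u r, φ r) ∈ Metric.closedBall (0 : EuclideanSpace ℝ (Fin N)) (R + R') ×ˢ κ :=
          ⟨mem_closedBall_zero_iff.2 (h1.trans (by linarith)), hφκ r hr⟩
        have h3 := hF.dist_le_mul ((u + s • v) r, ψ r) (u r, φ r)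
        have h4 : P.f (u r) (φ r) = F (u r, φ r) := hFf hmem
        rw [h4, ← dist_eq_norm, ← mul_add]
        refine h3.trans (mul_le_mul_of_nonneg_left ?_ C₁.2)
        rw [Prod.dist_eq]
        have h5 : dist ((u + s • v) r) (u r) ≤ |s| * R' := by
          rw [dist_eq_norm, Pi.add_apply, add_sub_cancel_left, Pi.smul_apply, norm_smul,
            Real.norm_eq_abs]
          exact mul_le_mul_of_nonneg_left h2 (abs_nonneg _)
        refine max_le (h5.trans (le_add_of_nonneg_right (norm_nonneg _))) ?_
        rw [dist_eq_norm]
        exact le_add_of_nonneg_left (by positivity)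
      rw [intervalIntegral.integral_add intervalIntegrable_const
        ((hcont.const_mul _).integrableOn_Icc.intervalIntegrable_of_mem_Icc P.zero_mem ht),
        intervalIntegral.integral_const, intervalIntegral.integral_const_mul, sub_zero,
        smul_eq_mul, mul_comm t] at h2
      refine h2.trans (add_le_add_left ?_ _)
      exact mul_le_mul_of_nonneg_left ht.2 (by positivity)
  have hψκ : ∀ t ∈ Icc 0 P.T, ψ t ∈ κ := fun t ht =>
    Metric.mem_cthickening_of_dist_le _ (φ t) _ _ ⟨t, ht, rfl⟩ (by
      rw [dist_eq_norm]; exact (hclose t ht).trans hs2.le)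
  refine ⟨ψ, ⟨hψc.continuousOn, fun t ht => hδΩ (hψκ t ht), fun t ht => ?_⟩, hclose⟩
  rw [hψ t ht]
  congr 1
  refine integral_congr_of_ae_restrict_Icc P.zero_mem ht ?_
  filter_upwards [hwR, P.ae_mem_Icc] with r h1 hr
  exact (hFf (⟨mem_closedBall_zero_iff.2 h1, hψκ r hr⟩ :
    ((u + s • v) r, ψ r) ∈ Metric.closedBall (0 : EuclideanSpace ℝ (Fin N)) (R + R') ×ˢ κ)).symm

end IsForwardSolution

end ControlProblem

/-! ### Partial derivatives of the dynamics and of the running cost -/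

theorem fderiv_prodMk_right_eq {E F G : Type*} [NormedAddCommGroup E] [NormedSpace ℝ E]
    [NormedAddCommGroup F] [NormedSpace ℝ F] [NormedAddCommGroup G] [NormedSpace ℝ G]
    {H : E × F → G} {w : E} {x : F} (hH : DifferentiableAt ℝ H (w, x)) :
    fderiv ℝ (fun y => H (w, y)) x = (fderiv ℝ H (w, x)).comp (ContinuousLinearMap.inr ℝ E F) :=
  (hH.hasFDerivAt.comp x (hasFDerivAt_prodMk_right w x)).fderiv

theorem fderiv_prodMk_left_eq {E F G : Type*} [NormedAddCommGroup E] [NormedSpace ℝ E]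
    [NormedAddCommGroup F] [NormedSpace ℝ F] [NormedAddCommGroup G] [NormedSpace ℝ G]
    {H : E × F → G} {w : E} {x : F} (hH : DifferentiableAt ℝ H (w, x)) :
    fderiv ℝ (fun y => H (y, x)) w = (fderiv ℝ H (w, x)).comp (ContinuousLinearMap.inl ℝ E F) :=
  (hH.hasFDerivAt.comp w (hasFDerivAt_prodMk_left w x)).fderiv

theorem inner_matVec_eq_sum {N : ℕ} (A : Matrix (Fin N) (Fin N) ℝ)
    (v w : EuclideanSpace ℝ (Fin N)) :
    inner ℝ v (matVec A w) = ∑ i, v i * ∑ j, A i j * w j := by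
  rw [matVec, Matrix.inner_toEuclideanCLM]
  rfl

theorem inner_matVec_comm {N : ℕ} {A : Matrix (Fin N) (Fin N) ℝ} (hA : A.IsSymm)
    (v w : EuclideanSpace ℝ (Fin N)) :
    inner ℝ v (matVec A w) = inner ℝ (matVec A v) w := by
  rw [real_inner_comm w, inner_matVec_eq_sum, inner_matVec_eq_sum]
  simp_rw [Finset.mul_sum]
  rw [Finset.sum_comm]
  refine Finset.sum_congr rfl fun i _ => Finset.sum_congr rfl fun j _ => ?_
  rw [← hA.apply i j]
  ring

namespace ControlProblem

variable {N l K : ℕ} {P : ControlProblem N l K}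

variable (P) in
theorem contDiffOn_L : ContDiffOn ℝ 1
    (fun p : EuclideanSpace ℝ (Fin N) × EuclideanSpace ℝ (Fin l) => P.L p.1 p.2)
    (univ ×ˢ P.Ω) := by
  simp only [L, inner_matVec_eq_sum]
  refine contDiffOn_const.mul (ContDiffOn.sum fun i _ => ContDiffOn.mul (by fun_prop)
    (ContDiffOn.sum fun j _ => ContDiffOn.mul ?_ (by fun_prop)))
  exact (P.contDiffOn_g i j).comp contDiffOn_snd fun p hp => hp.2

variable (P) in
theorem differentiableAt_f (w : EuclideanSpace ℝ (Fin N)) {x : EuclideanSpace ℝ (Fin l)}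
    (hx : x ∈ P.Ω) : DifferentiableAt ℝ
      (fun p : EuclideanSpace ℝ (Fin N) × EuclideanSpace ℝ (Fin l) => P.f p.1 p.2) (w, x) :=
  (P.contDiffOn_f.contDiffAt (isOpen_univ_prod.mem_nhds ⟨trivial, hx⟩)).differentiableAt
    one_ne_zero

variable (P) in
theorem differentiableAt_L (w : EuclideanSpace ℝ (Fin N)) {x : EuclideanSpace ℝ (Fin l)}
    (hx : x ∈ P.Ω) : DifferentiableAt ℝ
      (fun p : EuclideanSpace ℝ (Fin N) × EuclideanSpace ℝ (Fin l) => P.L p.1 p.2) (w, x) :=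
  (P.contDiffOn_L.contDiffAt (isOpen_univ_prod.mem_nhds ⟨trivial, hx⟩)).differentiableAt
    one_ne_zero

/-- Partial Jacobians are blocks of the joint derivative, which is continuous on `univ ×ˢ Ω`; their
measurability and boundedness along the trajectory come from there. -/
theorem fu_eq {u : Signal N} {φ : Signal l} {t : ℝ} (h : φ t ∈ P.Ω) :
    P.fu u φ t = (fderiv ℝ (fun p : EuclideanSpace ℝ (Fin N) × EuclideanSpace ℝ (Fin l) =>
      P.f p.1 p.2) (u t, φ t)).comp (ContinuousLinearMap.inl ℝ _ _) :=
  fderiv_prodMk_left_eq (P.differentiableAt_f (u t) h)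

theorem fφ_eq {u : Signal N} {φ : Signal l} {t : ℝ} (h : φ t ∈ P.Ω) :
    P.fφ u φ t = (fderiv ℝ (fun p : EuclideanSpace ℝ (Fin N) × EuclideanSpace ℝ (Fin l) =>
      P.f p.1 p.2) (u t, φ t)).comp (ContinuousLinearMap.inr ℝ _ _) :=
  fderiv_prodMk_right_eq (P.differentiableAt_f (u t) h)

theorem Lφ_eq {u : Signal N} {φ : Signal l} {t : ℝ} (h : φ t ∈ P.Ω) :
    P.Lφ u φ t = (InnerProductSpace.toDual ℝ _).symm
      ((fderiv ℝ (fun p : EuclideanSpace ℝ (Fin N) × EuclideanSpace ℝ (Fin l) =>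
        P.L p.1 p.2) (u t, φ t)).comp (ContinuousLinearMap.inr ℝ _ _)) :=
  congrArg _ (fderiv_prodMk_right_eq (P.differentiableAt_L (u t) h))

theorem inner_Lφ {u : Signal N} {φ : Signal l} {t : ℝ} (h : φ t ∈ P.Ω)
    (y : EuclideanSpace ℝ (Fin l)) :
    inner ℝ (P.Lφ u φ t) y = fderiv ℝ (fun p : EuclideanSpace ℝ (Fin N) ×
      EuclideanSpace ℝ (Fin l) => P.L p.1 p.2) (u t, φ t) (0, y) := by
  rw [Lφ_eq h, InnerProductSpace.toDual_symm_apply]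
  rfl

/-- Symmetry of `g` merges the two halves of the derivative of the quadratic form. -/
theorem fderiv_L_inl (w v : EuclideanSpace ℝ (Fin N)) {x : EuclideanSpace ℝ (Fin l)}
    (hx : x ∈ P.Ω) :
    fderiv ℝ (fun p : EuclideanSpace ℝ (Fin N) × EuclideanSpace ℝ (Fin l) => P.L p.1 p.2) (w, x)
      (v, 0) = inner ℝ (matVec (P.g x) w) v := by
  have h1 : fderiv ℝ (fun y => P.L y x) w v = fderiv ℝ (fun p : EuclideanSpace ℝ (Fin N) ×
      EuclideanSpace ℝ (Fin l) => P.L p.1 p.2) (w, x) (v, 0) := by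
    rw [fderiv_prodMk_left_eq (P.differentiableAt_L w hx)]
    rfl
  have hid := hasFDerivAt_id (𝕜 := ℝ) w
  have h2 : HasFDerivAt (fun y => P.L y x) _ w :=
    (hid.inner ℝ ((Matrix.toEuclideanCLM (n := Fin N) (𝕜 := ℝ) (P.g x)).hasFDerivAt.comp w
      hid)).const_mul (1 / 2 : ℝ)
  rw [← h1, h2.fderiv]
  have h3 := inner_matVec_comm (P.g_symm x hx) w v
  simp only [matVec] at h3 ⊢
  simp [fderivInnerCLM_apply, h3, real_inner_comm v]
  ring

/-! ### The adjoint equation -/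

section Adjoint

variable {u : Signal N} {φ η η' : Signal l}

theorem IsForwardSolution.memLp_fφ (hφ : P.IsForwardSolution u φ) (hu : u ∈ P.controls) :
    MemLp (P.fφ u φ) ⊤ P.timeMeasure := by
  have h : MemLp (fun t => (fderiv ℝ (fun p : EuclideanSpace ℝ (Fin N) ×
      EuclideanSpace ℝ (Fin l) => P.f p.1 p.2) (u t, φ t)).comp
        (ContinuousLinearMap.inr ℝ _ _)) ⊤ P.timeMeasure :=
    memLp_comp (H := fun q => (fderiv ℝ (fun p : EuclideanSpace ℝ (Fin N) ×
      EuclideanSpace ℝ (Fin l) => P.f p.1 p.2) q).comp (ContinuousLinearMap.inr ℝ _ _))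
      hu hφ.1 hφ.2.1 ((P.contDiffOn_f.continuousOn_fderiv_of_isOpen isOpen_univ_prod
        le_rfl).clm_comp continuousOn_const)
  exact h.ae_eq (P.ae_mem_Icc.mono fun t ht => (fφ_eq (hφ.2.1 t ht)).symm)

theorem IsForwardSolution.memLp_fu (hφ : P.IsForwardSolution u φ) (hu : u ∈ P.controls) :
    MemLp (P.fu u φ) ⊤ P.timeMeasure := by
  have h : MemLp (fun t => (fderiv ℝ (fun p : EuclideanSpace ℝ (Fin N) ×
      EuclideanSpace ℝ (Fin l) => P.f p.1 p.2) (u t, φ t)).comp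
        (ContinuousLinearMap.inl ℝ _ _)) ⊤ P.timeMeasure :=
    memLp_comp (H := fun q => (fderiv ℝ (fun p : EuclideanSpace ℝ (Fin N) ×
      EuclideanSpace ℝ (Fin l) => P.f p.1 p.2) q).comp (ContinuousLinearMap.inl ℝ _ _))
      hu hφ.1 hφ.2.1 ((P.contDiffOn_f.continuousOn_fderiv_of_isOpen isOpen_univ_prod
        le_rfl).clm_comp continuousOn_const)
  exact h.ae_eq (P.ae_mem_Icc.mono fun t ht => (fu_eq (hφ.2.1 t ht)).symm)

theorem IsForwardSolution.memLp_Lφ (hφ : P.IsForwardSolution u φ) (hu : u ∈ P.controls) :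
    MemLp (P.Lφ u φ) ⊤ P.timeMeasure := by
  have h := memLp_comp (H := fun q => (InnerProductSpace.toDual ℝ _).symm
      ((fderiv ℝ (fun p : EuclideanSpace ℝ (Fin N) × EuclideanSpace ℝ (Fin l) =>
        P.L p.1 p.2) q).comp (ContinuousLinearMap.inr ℝ _ _)))
      hu hφ.1 hφ.2.1 ((LinearIsometryEquiv.continuous _).comp_continuousOn
        ((P.contDiffOn_L.continuousOn_fderiv_of_isOpen isOpen_univ_prod
        le_rfl).clm_comp continuousOn_const))
  exact h.ae_eq (P.ae_mem_Icc.mono fun t ht => (Lφ_eq (hφ.2.1 t ht)).symm)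

/-- Applying the adjoint of a bounded operator-valued signal to a bounded signal. -/
theorem memLp_adjoint_apply {E F : Type*} [NormedAddCommGroup E] [InnerProductSpace ℝ E]
    [CompleteSpace E] [NormedAddCommGroup F] [InnerProductSpace ℝ F] [CompleteSpace F]
    {A : ℝ → E →L[ℝ] F} {η : ℝ → F} (hA : MemLp A ⊤ P.timeMeasure)
    (hη : MemLp η ⊤ P.timeMeasure) :
    MemLp (fun t => ContinuousLinearMap.adjoint (A t) (η t)) ⊤ P.timeMeasure := by
  obtain ⟨R, hR0, hR⟩ := exists_ae_norm_le hA
  obtain ⟨R', -, hR'⟩ := exists_ae_norm_le hη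
  have hm : AEStronglyMeasurable (fun t => ContinuousLinearMap.adjoint (A t)) P.timeMeasure :=
    (LinearIsometryEquiv.continuous _).comp_aestronglyMeasurable hA.1
  refine memLp_top_of_bound ((isBoundedBilinearMap_apply (𝕜 := ℝ) (E := F)
    (F := E)).continuous.comp_aestronglyMeasurable (hm.prodMk hη.1)) (R * R') ?_
  filter_upwards [hR, hR'] with t h1 h2
  refine (ContinuousLinearMap.le_opNorm _ _).trans ?_
  rw [LinearIsometryEquiv.norm_map]
  gcongr

theorem IsForwardSolution.memLp_adjointRhs (hφ : P.IsForwardSolution u φ) (hu : u ∈ P.controls)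
    (hη : MemLp η ⊤ P.timeMeasure) : MemLp (P.adjointRhs u φ η) ⊤ P.timeMeasure :=
  (hφ.memLp_Lφ hu).sub (memLp_adjoint_apply (hφ.memLp_fφ hu) hη)

variable (P) in
/-- The sum of the jumps of the adjoint variable after time `t`. -/
noncomputable def laterJumps (φ : Signal l) (t : ℝ) : EuclideanSpace ℝ (Fin l) :=
  ∑ k, (Iio (P.obs k)).indicator (fun _ => gradient (P.F k) (φ (P.obs k))) t

theorem memLp_laterJumps : MemLp (P.laterJumps φ) ⊤ P.timeMeasure :=
  memLp_finsetSum _ fun _ _ => (memLp_const _).indicator measurableSet_Iio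

theorem laterJumps_T : P.laterJumps φ P.T = 0 :=
  Finset.sum_eq_zero fun k _ => indicator_of_notMem (notMem_Iio.2 (P.obs_mem k).2) _

theorem laterJumps_eq {a b : ℝ} (hab : a ≤ b) (h : ∀ k, P.obs k ∉ Ioc a b) :
    P.laterJumps φ a = P.laterJumps φ b := by
  refine Finset.sum_congr rfl fun k _ => ?_
  by_cases hb : b < P.obs k
  · rw [indicator_of_mem (mem_Iio.2 (hab.trans_lt hb)), indicator_of_mem (mem_Iio.2 hb)]
  · have ha : ¬ a < P.obs k := fun ha => h k ⟨ha, not_lt.1 hb⟩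
    rw [indicator_of_notMem (notMem_Iio.2 (not_lt.1 ha)),
      indicator_of_notMem (notMem_Iio.2 (not_lt.1 hb))]

variable (P) in
theorem eventually_obs_notMem_Ioc (t : ℝ) : ∀ᶠ b in 𝓝[≥] t, ∀ k, P.obs k ∉ Ioc t b := by
  refine eventually_all.2 fun k => ?_
  rcases le_or_gt (P.obs k) t with h | h
  · exact Eventually.of_forall fun b hb => hb.1.not_ge h
  · filter_upwards [mem_nhdsWithin_of_mem_nhds (Iio_mem_nhds h)] with b hb hb'
    exact hb.not_ge hb'.2

open Classical in
-- `laterJumps` is a right-continuous step function with exactly the jumps prescribed by the reset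
-- condition. The half-line `Iio` drops an observation at its own time, so one at time `0`
-- contributes nothing on `[0, T]`.
theorem eventually_laterJumps_eq (t : ℝ) : ∀ᶠ s in 𝓝[<] t, P.laterJumps φ s =
    P.laterJumps φ t + ∑ k, if P.obs k = t then gradient (P.F k) (φ t) else 0 := by
  have h : ∀ k, ∀ᶠ s in 𝓝[<] t, (s < P.obs k ↔ t ≤ P.obs k) := fun k => by
    rcases lt_or_ge (P.obs k) t with h | h
    · filter_upwards [mem_nhdsWithin_of_mem_nhds (Ioi_mem_nhds h)] with s hs
      exact iff_of_false (not_lt.2 (le_of_lt hs)) (not_le.2 h)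
    · filter_upwards [self_mem_nhdsWithin] with s hs
      exact iff_of_true (lt_of_lt_of_le hs h) h
  filter_upwards [eventually_all.2 h] with s hs
  rw [laterJumps, laterJumps, ← Finset.sum_add_distrib]
  refine Finset.sum_congr rfl fun k _ => ?_
  simp only [indicator, mem_Iio, hs k]
  rcases lt_trichotomy t (P.obs k) with h | h | h
  · simp [h, h.le, h.ne']
  · simp [← h]
  · simp [h.not_ge, h.not_gt, h.ne]

theorem continuousOn_integral_right {E : Type*} [NormedAddCommGroup E] [NormedSpace ℝ E]
    {a : ℝ → E} (ha : IntegrableOn a (Icc 0 P.T)) :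
    ContinuousOn (fun t => ∫ s in t..P.T, a s) (Icc 0 P.T) := by
  refine ((continuousOn_const (c := ∫ s in (0 : ℝ)..P.T, a s)).sub ha.continuousOn_primitive_Icc).congr fun t ht => ?_
  exact (intervalIntegral.integral_interval_sub_left
    (ha.intervalIntegrable_of_mem_Icc P.zero_mem P.T_mem)
    (ha.intervalIntegrable_of_mem_Icc P.zero_mem ht)).symm

/-- From the left the reset condition cancels the jump; from the right the integral equation holds
up to the next observation. -/
theorem IsAdjointSolution.continuousOn_sub_laterJumps (hη : P.IsAdjointSolution u φ η) :
    ContinuousOn (fun t => η t - P.laterJumps φ t) (Icc 0 P.T) := by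
  intro t ht
  have hleft : ContinuousWithinAt (fun t => η t - P.laterJumps φ t) (Icc 0 P.T ∩ Iio t) t := by
    rcases ht.1.eq_or_lt with h0 | h0
    · have : Icc 0 P.T ∩ Iio t = ∅ := by
        ext s; simp only [mem_inter_iff, mem_Icc, mem_Iio, mem_empty_iff_false, iff_false]
        rintro ⟨⟨h1, -⟩, h2⟩; linarith
      rw [this, ContinuousWithinAt, nhdsWithin_empty]
      exact tendsto_bot
    · refine ContinuousWithinAt.mono (t := Iio t) ?_ inter_subset_right
      have h1 := hη.2.1 t ⟨h0, ht.2⟩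
      have h2 := eventually_laterJumps_eq (P := P) (φ := φ) t
      have h3 := (h1.sub_const (P.laterJumps φ t +
        ∑ k, if P.obs k = t then gradient (P.F k) (φ t) else 0)).congr' (f₂ := fun s => η s - P.laterJumps φ s)
        (h2.mono fun s hs => by simp only [hs])
      refine h3.mono_right (le_of_eq ?_)
      congr 1
      abel_nf
  have hright : ContinuousWithinAt (fun t => η t - P.laterJumps φ t) (Icc 0 P.T ∩ Ici t) t := by
    rcases ht.2.eq_or_lt with hT | hT
    · have : Icc 0 P.T ∩ Ici t ⊆ {t} := fun s hs => le_antisymm (hs.1.2.trans hT.ge) hs.2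
      exact continuousWithinAt_singleton.mono this
    · have hev : ∀ᶠ b in 𝓝[>] t, (∀ k, P.obs k ∉ Ioc t b) ∧ b ∈ Ioo t P.T :=
        ((P.eventually_obs_notMem_Ioc t).filter_mono (nhdsWithin_mono _ Ioi_subset_Ici_self)).and
          (Ioo_mem_nhdsGT hT)
      obtain ⟨b, hb, hbt, hbT⟩ := hev.exists
      have hsub : ∀ s ∈ Icc t b, ∀ k, P.obs k ∉ Ioc t s := fun s hs k hk =>
        hb k ⟨hk.1, hk.2.trans hs.2⟩
      have hc : ContinuousOn (fun t => η t - P.laterJumps φ t) (Icc t b) := by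
        have hint := (hη.1 t b ht.1 hbt.le hbT.le hb).1
        have hprim : ContinuousOn (fun s => ∫ r in t..s, P.adjointRhs u φ η r) (Icc t b) :=
          ((intervalIntegrable_iff_integrableOn_Icc_of_le
            hbt.le).1 hint).continuousOn_primitive_Icc
        refine ((continuousOn_const (c := η t)).add hprim |>.sub
          (continuousOn_const (c := P.laterJumps φ t))).congr fun s hs => ?_
        have h1 := (hη.1 t s ht.1 hs.1 (hs.2.trans hbT.le) (hsub s hs)).2
        simp only [← laterJumps_eq (φ := φ) hs.1 (hsub s hs), h1, Pi.add_apply, Pi.sub_apply]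
      have h1 : ContinuousWithinAt (fun t => η t - P.laterJumps φ t) (Ici t) t :=
        (hc t ⟨le_rfl, hbt.le⟩).mono_of_mem_nhdsWithin (Icc_mem_nhdsGE hbt)
      exact h1.mono inter_subset_right
  refine (continuousWithinAt_union.2 ⟨hleft, hright⟩).mono fun s hs => ?_
  rcases lt_or_ge s t with h | h
  · exact Or.inl ⟨hs, h⟩
  · exact Or.inr ⟨hs, h⟩

theorem IsAdjointSolution.memLp (hη : P.IsAdjointSolution u φ η) : MemLp η ⊤ P.timeMeasure := by
  have h := (memLp_of_continuousOn hη.continuousOn_sub_laterJumps).add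
    (memLp_laterJumps (P := P) (φ := φ))
  exact h.ae_eq (Eventually.of_forall fun t => by simp)

/-- Integral form of the adjoint equation. -/
theorem IsAdjointSolution.eq_laterJumps_sub (hη : P.IsAdjointSolution u φ η)
    (hφ : P.IsForwardSolution u φ) (hu : u ∈ P.controls) {t : ℝ} (ht : t ∈ Icc 0 P.T) :
    η t = P.laterJumps φ t - ∫ s in t..P.T, P.adjointRhs u φ η s := by
  have hint := integrableOn_of_memLp (hφ.memLp_adjointRhs hu hη.memLp)
  -- To the right of each `x`, `e` is constant until the next observation, so its right derivative
  -- vanishes. With continuity this makes `e` constant on `[0, T]`, without an induction over the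
  -- observation times.
  set e : ℝ → EuclideanSpace ℝ (Fin l) := fun t =>
    η t - P.laterJumps φ t - ∫ s in (0 : ℝ)..t, P.adjointRhs u φ η s with he
  have hconst : ∀ x ∈ Icc 0 P.T, e x = e 0 := by
    refine constant_of_has_deriv_right_zero
      (hη.continuousOn_sub_laterJumps.sub hint.continuousOn_primitive_Icc) fun x hx => ?_
    refine (hasDerivWithinAt_const x (Ici x) (e x)).congr_of_eventuallyEq ?_ rfl
    filter_upwards [P.eventually_obs_notMem_Ioc x, Icc_mem_nhdsGE hx.2] with y hy hyT
    have h1 := (hη.1 x y hx.1 hyT.1 hyT.2 hy).2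
    have h2 := intervalIntegral.integral_add_adjacent_intervals
      (hint.intervalIntegrable_of_mem_Icc P.zero_mem (Ico_subset_Icc_self hx))
      (hint.intervalIntegrable_of_mem_Icc (Ico_subset_Icc_self hx)
        (⟨hx.1.trans hyT.1, hyT.2⟩ : y ∈ Icc 0 P.T))
    simp only [he, ← laterJumps_eq (φ := φ) hyT.1 hy, h1, ← h2]
    abel
  have h1 : e t = e P.T := (hconst t ht).trans (hconst _ P.T_mem).symm
  have h2 := intervalIntegral.integral_add_adjacent_intervals
    (hint.intervalIntegrable_of_mem_Icc P.zero_mem ht)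
    (hint.intervalIntegrable_of_mem_Icc ht P.T_mem)
  simp only [he, hη.2.2, laterJumps_T, ← h2] at h1
  rw [sub_sub, sub_eq_iff_eq_add] at h1
  rw [h1]
  abel

/-- Converse of `eq_laterJumps_sub`: the integral is continuous, so `laterJumps` alone produces the
jumps. -/
theorem isAdjointSolution_of_eq (hη : IntegrableOn (P.adjointRhs u φ η) (Icc 0 P.T))
    (h : ∀ t ∈ Icc 0 P.T, η t = P.laterJumps φ t - ∫ s in t..P.T, P.adjointRhs u φ η s) :
    P.IsAdjointSolution u φ η := by
  refine ⟨fun a b ha hab hb hobs => ?_, fun t ht => ?_, ?_⟩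
  · have ha' : a ∈ Icc 0 P.T := ⟨ha, hab.trans hb⟩
    have hb' : b ∈ Icc 0 P.T := ⟨ha.trans hab, hb⟩
    refine ⟨hη.intervalIntegrable_of_mem_Icc ha' hb', ?_⟩
    rw [h a ha', h b hb', laterJumps_eq hab hobs,
      ← intervalIntegral.integral_add_adjacent_intervals
        (hη.intervalIntegrable_of_mem_Icc ha' hb') (hη.intervalIntegrable_of_mem_Icc hb' P.T_mem)]
    abel
  · have ht' := Ioc_subset_Icc_self ht
    have h1 : Tendsto (fun s => ∫ r in s..P.T, P.adjointRhs u φ η r) (𝓝[<] t)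
        (𝓝 (∫ r in t..P.T, P.adjointRhs u φ η r)) := by
      refine ((continuousOn_integral_right hη) t ht').mono_left ?_
      refine nhdsWithin_le_of_mem ?_
      filter_upwards [Ioo_mem_nhdsLT ht.1] with s hs
      exact ⟨hs.1.le, hs.2.le.trans ht.2⟩
    have h2 := (h1.const_sub (P.laterJumps φ t +
      ∑ k, if P.obs k = t then gradient (P.F k) (φ t) else 0))
    rw [h t ht', sub_add_eq_add_sub]
    refine Tendsto.congr' ?_ h2
    filter_upwards [eventually_laterJumps_eq (P := P) (φ := φ) t, Ioo_mem_nhdsLT ht.1] with s hs h0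
    rw [h s ⟨h0.1.le, h0.2.le.trans ht.2⟩, hs]
  · rw [h _ P.T_mem, laterJumps_T, intervalIntegral.integral_same, sub_zero]

theorem IsAdjointSolution.eqOn (hη : P.IsAdjointSolution u φ η)
    (hη' : P.IsAdjointSolution u φ η') (hφ : P.IsForwardSolution u φ) (hu : u ∈ P.controls) :
    EqOn η' η (Icc 0 P.T) := by
  obtain ⟨R, hR0, hR⟩ := exists_ae_norm_le (hφ.memLp_fφ hu)
  have hint := integrableOn_of_memLp (hφ.memLp_adjointRhs hu hη.memLp)
  have hint' := integrableOn_of_memLp (hφ.memLp_adjointRhs hu hη'.memLp)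
  have hd : ∀ t ∈ Icc 0 P.T, η' t - η t =
      -∫ s in t..P.T, (P.adjointRhs u φ η' s - P.adjointRhs u φ η s) := fun t ht => by
    rw [hη.eq_laterJumps_sub hφ hu ht, hη'.eq_laterJumps_sub hφ hu ht, sub_sub_sub_cancel_left,
      intervalIntegral.integral_sub (hint'.intervalIntegrable_of_mem_Icc ht P.T_mem)
        (hint.intervalIntegrable_of_mem_Icc ht P.T_mem), neg_sub]
  have hcont : ContinuousOn (fun t => ‖η' t - η t‖) (Icc 0 P.T) :=
    ((continuousOn_integral_right (hint'.sub hint)).neg.congr hd).norm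
  -- The difference of two solutions vanishes at `T`; reversing time turns this into the initial
  -- condition for Grönwall.
  have hrefl : ∀ t ∈ Icc 0 P.T, P.T - t ∈ Icc 0 P.T := fun t ht =>
    ⟨sub_nonneg.2 ht.2, sub_le_self _ ht.1⟩
  have hw : ∀ t ∈ Icc 0 P.T, ‖η' (P.T - t) - η (P.T - t)‖ ≤ 0 * Real.exp (R * t) := by
    refine le_mul_exp_of_le_add_integral hR0
      (hcont.comp (by fun_prop : Continuous fun t => P.T - t).continuousOn hrefl) fun t ht => ?_
    have hmono : ∫ s in (0 : ℝ)..t, ‖η' (P.T - s) - η (P.T - s)‖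
        = ∫ s in (P.T - t)..P.T, ‖η' s - η s‖ := by
      rw [intervalIntegral.integral_comp_sub_left (fun s => ‖η' s - η s‖) P.T, sub_zero]
    rw [zero_add, hmono, hd _ (hrefl t ht), norm_neg, ← intervalIntegral.integral_const_mul]
    refine intervalIntegral.norm_integral_le_of_norm_le (hrefl t ht).2 ?_
      ((hcont.const_mul _).integrableOn_Icc.intervalIntegrable_of_mem_Icc (hrefl t ht) P.T_mem)
    filter_upwards [(ae_restrict_iff' measurableSet_Icc).1 hR] with s hs hst
    rw [adjointRhs, adjointRhs, sub_sub_sub_cancel_left, ← map_sub, norm_sub_rev (η' s)]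
    refine (ContinuousLinearMap.le_opNorm _ _).trans ?_
    rw [LinearIsometryEquiv.norm_map]
    exact mul_le_mul_of_nonneg_right (hs ⟨(hrefl t ht).1.trans hst.1.le, hst.2⟩) (norm_nonneg _)
  intro t ht
  have := hw _ (hrefl t ht)
  rw [zero_mul, sub_sub_cancel] at this
  exact sub_eq_zero.1 (norm_le_zero_iff.1 this)

theorem IsForwardSolution.exists_isAdjointSolution (hφ : P.IsForwardSolution u φ)
    (hu : u ∈ P.controls) : ∃ η, P.IsAdjointSolution u φ η := by
  obtain ⟨R, hR0, hR⟩ := exists_ae_norm_le (hφ.memLp_fφ hu)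
  have hmem : ∀ ψ : Signal l, Continuous ψ →
      MemLp (fun t => P.laterJumps φ t + ψ (P.T - t)) ⊤ P.timeMeasure := fun ψ hψ =>
    memLp_laterJumps.add
      (memLp_of_continuousOn (hψ.comp (continuous_const.sub continuous_id)).continuousOn)
  -- With `η(t) = laterJumps(t) + z(T - t)` the jumps are absorbed and time is reversed: `z' = F(t,
  -- z)`, `z(0) = 0`. Only the value at `T - t` of the signal passed to `adjointRhs` matters.
  set F : ℝ → EuclideanSpace ℝ (Fin l) → EuclideanSpace ℝ (Fin l) := fun t x =>
    -P.adjointRhs u φ (fun r => P.laterJumps φ r + x) (P.T - t) with hF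
  have hFint : ∀ ψ : Signal l, Continuous ψ → IntegrableOn (fun t => F t (ψ t)) (Icc 0 P.T) := by
    intro ψ hψ
    have h1 := integrableOn_of_memLp (hφ.memLp_adjointRhs hu (hmem ψ hψ))
    have h2 := ((h1.intervalIntegrable_of_mem_Icc P.T_mem P.zero_mem).comp_sub_left P.T).neg
    rw [sub_self, sub_zero, intervalIntegrable_iff_integrableOn_Icc_of_le P.T_pos.le] at h2
    refine h2.congr_fun (fun s _ => ?_) measurableSet_Icc
    simp [hF, adjointRhs]
  have hFLip : ∀ᵐ t ∂volume.restrict (Icc 0 P.T), LipschitzWith R.toNNReal (F t) := by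
    -- Reflection preserves null sets, so the almost-everywhere bound on `f_φ` survives the time
    -- reversal.
    have h1 := (Measure.measurePreserving_sub_left volume P.T).quasiMeasurePreserving.tendsto_ae.eventually
      ((ae_restrict_iff' measurableSet_Icc).1 hR)
    refine (ae_restrict_iff' measurableSet_Icc).2 ?_
    filter_upwards [h1] with t ht htT
    refine LipschitzWith.of_dist_le_mul fun x y => ?_
    rw [dist_eq_norm, dist_eq_norm', Real.coe_toNNReal _ hR0]
    simp only [hF, adjointRhs]
    rw [neg_sub_neg, sub_sub_sub_cancel_left, ← map_sub, add_sub_add_left_eq_sub, norm_sub_rev y x]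
    refine (ContinuousLinearMap.le_opNorm _ _).trans ?_
    rw [LinearIsometryEquiv.norm_map]
    exact mul_le_mul_of_nonneg_right (ht ⟨sub_nonneg.2 htT.2, sub_le_self _ htT.1⟩) (norm_nonneg _)
  obtain ⟨z, hzc, hz⟩ := exists_forall_eq_add_integral P.T_pos.le F R.toNNReal 0 hFint hFLip
  refine ⟨fun t => P.laterJumps φ t + z (P.T - t), isAdjointSolution_of_eq
    (integrableOn_of_memLp (hφ.memLp_adjointRhs hu (hmem z hzc))) fun t ht => ?_⟩
  simp only [hz _ (⟨sub_nonneg.2 ht.2, sub_le_self _ ht.1⟩ : P.T - t ∈ Icc 0 P.T)]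
  rw [intervalIntegral.integral_neg, zero_add, ← sub_eq_add_neg]
  congr 1
  have h1 := intervalIntegral.integral_comp_sub_left (a := 0) (b := P.T - t)
    (P.adjointRhs u φ (fun r => P.laterJumps φ r + z (P.T - r))) P.T
  rw [sub_sub_cancel, sub_zero] at h1
  rw [← h1]
  refine intervalIntegral.integral_congr fun s _ => ?_
  simp only [adjointRhs, sub_sub_cancel]

end Adjoint

end ControlProblem

/-! ### First-order expansion of the objective -/

theorem continuous_matVec {N : ℕ} : Continuous
    fun p : Matrix (Fin N) (Fin N) ℝ × EuclideanSpace ℝ (Fin N) => matVec p.1 p.2 :=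
  (PiLp.continuous_toLp 2 _).comp
    (continuous_fst.matrix_mulVec ((PiLp.continuous_ofLp 2 _).comp continuous_snd))

namespace ControlProblem

variable {N l K : ℕ} {P : ControlProblem N l K}

variable (P) in
theorem intervalIntegral_eq {E : Type*} [NormedAddCommGroup E] [NormedSpace ℝ E] (f : ℝ → E) :
    ∫ t in (0 : ℝ)..P.T, f t = ∫ t, f t ∂P.timeMeasure := by
  rw [intervalIntegral.integral_of_le P.T_pos.le, ← integral_Icc_eq_integral_Ioc, timeMeasure]

theorem memLp_inner {E : Type*} [NormedAddCommGroup E] [InnerProductSpace ℝ E] {f g : ℝ → E}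
    (hf : MemLp f ⊤ P.timeMeasure) (hg : MemLp g ⊤ P.timeMeasure) :
    MemLp (fun t => inner ℝ (f t) (g t)) ⊤ P.timeMeasure := by
  obtain ⟨R, hR0, hR⟩ := exists_ae_norm_le hf
  obtain ⟨R', -, hR'⟩ := exists_ae_norm_le hg
  refine memLp_top_of_bound (hf.1.inner hg.1) (R * R') ?_
  filter_upwards [hR, hR'] with t h1 h2
  refine (norm_inner_le_norm _ _).trans ?_
  gcongr

variable (P) in
theorem continuousOn_g : ContinuousOn P.g P.Ω :=
  continuousOn_pi.2 fun i => continuousOn_pi.2 fun j => (P.contDiffOn_g i j).continuousOn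

section Gradient

variable {u v w : Signal N} {φ ψ η : Signal l}

theorem IsForwardSolution.memLp_matVec_g (hφ : P.IsForwardSolution u φ)
    (hw : w ∈ P.controls) : MemLp (fun t => matVec (P.g (φ t)) (w t)) ⊤ P.timeMeasure := by
  have hg : ContinuousOn (fun q : EuclideanSpace ℝ (Fin N) × EuclideanSpace ℝ (Fin l) => P.g q.2)
      (univ ×ˢ P.Ω) := P.continuousOn_g.comp continuousOn_snd fun _ hq => hq.2
  exact memLp_comp hw hφ.1 hφ.2.1 (continuous_matVec.comp_continuousOn (hg.prodMk continuousOn_fst))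

theorem IsForwardSolution.regularGradient_mem_controls (hφ : P.IsForwardSolution u φ)
    (hu : u ∈ P.controls) (hη : MemLp η ⊤ P.timeMeasure) :
    P.regularGradient u φ η ∈ P.controls := by
  have h := memLp_adjoint_apply (hφ.memLp_fu hu) hη
  exact (hφ.memLp_matVec_g hu).sub h

/-- The `k`-th jump is present in `laterJumps` exactly before `tₖ`. For `b` the derivative of `ψ -
φ`, this yields the values of `ψ - φ` at the observation times. -/
theorem integral_inner_laterJumps {b : Signal l} (hb : MemLp b ⊤ P.timeMeasure) :
    ∫ t, inner ℝ (P.laterJumps φ t) (b t) ∂P.timeMeasure =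
      ∑ k, inner ℝ (gradient (P.F k) (φ (P.obs k))) (∫ t in (0 : ℝ)..P.obs k, b t) := by
  have hpt : ∀ t, inner ℝ (P.laterJumps φ t) (b t) =
      ∑ k, (Iio (P.obs k)).indicator
        (fun t => inner ℝ (gradient (P.F k) (φ (P.obs k))) (b t)) t := fun t => by
    rw [laterJumps, sum_inner]
    refine Finset.sum_congr rfl fun k _ => ?_
    by_cases h : t < P.obs k <;> simp [indicator, h]
  simp_rw [hpt]
  have hint : ∀ k, Integrable (fun t => inner ℝ (gradient (P.F k) (φ (P.obs k))) (b t))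
      P.timeMeasure := fun k => (hb.integrable le_top).const_inner _
  rw [integral_finsetSum _ fun k _ => (hint k).indicator measurableSet_Iio]
  refine Finset.sum_congr rfl fun k _ => ?_
  have hk := P.obs_mem k
  have hset : Iio (P.obs k) ∩ Icc 0 P.T = Ico 0 (P.obs k) := by
    ext t
    exact ⟨fun h => ⟨h.2.1, h.1⟩, fun h => ⟨h.2, h.1, h.2.le.trans hk.2⟩⟩
  rw [integral_indicator measurableSet_Iio, timeMeasure,
    Measure.restrict_restrict measurableSet_Iio, hset, integral_Ico_eq_integral_Ioc,
    intervalIntegral.integral_of_le hk.1]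
  exact integral_inner ((integrableOn_of_memLp hb).mono_set fun t ht =>
    ⟨ht.1.le, ht.2.trans hk.2⟩) _

/-- The adjoint equation tested with the difference of two solutions of the forward equation. -/
theorem IsAdjointSolution.sum_inner_gradient_eq (hη : P.IsAdjointSolution u φ η)
    (hφ : P.IsForwardSolution u φ) (hu : u ∈ P.controls)
    (hψ : P.IsForwardSolution w ψ) (hw : w ∈ P.controls) :
    ∑ k, inner ℝ (gradient (P.F k) (φ (P.obs k))) (ψ (P.obs k) - φ (P.obs k)) =
      (∫ t, inner ℝ (η t) (P.f (w t) (ψ t) - P.f (u t) (φ t)) ∂P.timeMeasure) +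
        ∫ t, inner ℝ (P.adjointRhs u φ η t) (ψ t - φ t) ∂P.timeMeasure := by
  have hb : MemLp (fun t => P.f (w t) (ψ t) - P.f (u t) (φ t)) ⊤ P.timeMeasure :=
    (hψ.memLp_f hw).sub (hφ.memLp_f hu)
  have ha := hφ.memLp_adjointRhs hu hη.memLp
  -- Integration by parts: `ψ - φ` is the primitive of the difference of the right-hand sides, and
  -- the tail integral of `adjointRhs` is `laterJumps - η`.
  have h1 : ∫ t, inner ℝ (P.adjointRhs u φ η t) (ψ t - φ t) ∂P.timeMeasure =
      ∫ t, inner ℝ (∫ s in t..P.T, P.adjointRhs u φ η s)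
        (P.f (w t) (ψ t) - P.f (u t) (φ t)) ∂P.timeMeasure := by
    rw [← P.intervalIntegral_eq, ← P.intervalIntegral_eq, integral_inner_integral_eq P.T_pos.le
      (integrableOn_of_memLp ha) (integrableOn_of_memLp hb)]
    refine intervalIntegral.integral_congr fun t ht => ?_
    rw [uIcc_of_le P.T_pos.le] at ht
    simp only [hφ.sub_eq_integral hu hψ hw ht]
  have h2 : ∫ t, inner ℝ (η t) (P.f (w t) (ψ t) - P.f (u t) (φ t)) ∂P.timeMeasure =
      (∫ t, inner ℝ (P.laterJumps φ t) (P.f (w t) (ψ t) - P.f (u t) (φ t)) ∂P.timeMeasure) -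
      ∫ t, inner ℝ (∫ s in t..P.T, P.adjointRhs u φ η s)
        (P.f (w t) (ψ t) - P.f (u t) (φ t)) ∂P.timeMeasure := by
    rw [← integral_sub ((memLp_inner memLp_laterJumps hb).integrable le_top)
      ((memLp_inner (memLp_of_continuousOn
        (continuousOn_integral_right (integrableOn_of_memLp ha))) hb).integrable le_top)]
    refine integral_congr_ae (P.ae_mem_Icc.mono fun t ht => ?_)
    simp only [hη.eq_laterJumps_sub hφ hu ht, inner_sub_left]
  rw [h1, h2, sub_add_cancel, integral_inner_laterJumps hb]
  refine Finset.sum_congr rfl fun k _ => ?_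
  rw [hφ.sub_eq_integral hu hψ hw (P.obs_mem k)]

/-- Uniform first order expansion of a `C¹` function along a perturbed trajectory. -/
theorem eventually_ae_norm_remainder_le {Y : Type*} [NormedAddCommGroup Y] [NormedSpace ℝ Y]
    {H : EuclideanSpace ℝ (Fin N) × EuclideanSpace ℝ (Fin l) → Y}
    (hH : ContDiffOn ℝ 1 H (univ ×ˢ P.Ω)) (hφ : P.IsForwardSolution u φ) (hu : u ∈ P.controls)
    (hv : v ∈ P.controls) {C : ℝ} {ε : ℝ} (hε : 0 < ε) :
    ∀ᶠ s : ℝ in 𝓝 0, ∀ ψ : Signal l, (∀ t ∈ Icc 0 P.T, ‖ψ t - φ t‖ ≤ C * |s|) →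
      ∀ᵐ t ∂P.timeMeasure, ‖H ((u + s • v) t, ψ t) - H (u t, φ t) -
        fderiv ℝ H (u t, φ t) (s • v t, ψ t - φ t)‖ ≤ ε * |s| := by
  obtain ⟨R, -, hR⟩ := exists_ae_norm_le hu
  obtain ⟨R', hR'0, hR'⟩ := exists_ae_norm_le hv
  -- `C' |s|` bounds the joint increment `(s v, ψ - φ)`; the summand `1` makes `C'` positive for the
  -- division.
  set C' : ℝ := max R' C + 1 with hC'
  have hC'0 : 0 < C' := by have := le_max_left R' C; linarith
  obtain ⟨δ, hδ, h⟩ := hH.exists_norm_sub_sub_le isOpen_univ_prod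
    ((isCompact_closedBall 0 R).prod hφ.isCompact_image)
    (prod_mono (subset_univ _) hφ.image_subset) (div_pos hε hC'0)
  have hs : ∀ᶠ s : ℝ in 𝓝 0, C' * |s| < δ :=
    (continuous_const.mul continuous_abs).continuousAt.eventually_lt continuousAt_const
      (by simpa using hδ)
  filter_upwards [hs] with s hs ψ hψ
  filter_upwards [hR, hR', P.ae_mem_Icc] with t h1 h2 ht
  have hdiff : ((u + s • v) t, ψ t) - (u t, φ t) = (s • v t, ψ t - φ t) := by
    ext1 <;> simp
  have hle : ‖((u + s • v) t, ψ t) - (u t, φ t)‖ ≤ C' * |s| := by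
    rw [hdiff, Prod.norm_def]
    refine max_le ?_ ((hψ t ht).trans ?_)
    · rw [norm_smul, Real.norm_eq_abs, mul_comm]
      refine mul_le_mul_of_nonneg_right (h2.trans ?_) (abs_nonneg s)
      have := le_max_left R' C; linarith
    · refine mul_le_mul_of_nonneg_right ?_ (abs_nonneg s)
      have := le_max_right R' C; linarith
  have key := h (u t, φ t) ⟨mem_closedBall_zero_iff.2 h1, t, ht, rfl⟩ _ (hle.trans_lt hs)
  rw [← hdiff]
  refine key.trans ?_
  calc ε / C' * ‖((u + s • v) t, ψ t) - (u t, φ t)‖ ≤ ε / C' * (C' * |s|) := by gcongr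
    _ = ε * |s| := by field_simp

/-- Only the finitely many points `φ(tₖ)` matter, so differentiability of `Fₖ` suffices and no
uniformity is needed. -/
theorem eventually_abs_observation_remainder_le (hφ : P.IsForwardSolution u φ) {C : ℝ}
    (hC : 0 ≤ C) {ε : ℝ} (hε : 0 < ε) :
    ∀ᶠ s : ℝ in 𝓝 0, ∀ ψ : Signal l, (∀ t ∈ Icc 0 P.T, ‖ψ t - φ t‖ ≤ C * |s|) →
      ∀ k, |P.F k (ψ (P.obs k)) - P.F k (φ (P.obs k)) -
        inner ℝ (gradient (P.F k) (φ (P.obs k))) (ψ (P.obs k) - φ (P.obs k))| ≤ ε * |s| := by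
  have h : ∀ k, ∀ᶠ s : ℝ in 𝓝 0, ∀ ψ : Signal l, (∀ t ∈ Icc 0 P.T, ‖ψ t - φ t‖ ≤ C * |s|) →
      |P.F k (ψ (P.obs k)) - P.F k (φ (P.obs k)) -
        inner ℝ (gradient (P.F k) (φ (P.obs k))) (ψ (P.obs k) - φ (P.obs k))| ≤ ε * |s| := by
    intro k
    have hd : DifferentiableAt ℝ (P.F k) (φ (P.obs k)) :=
      (P.differentiableOn_F k).differentiableAt (P.isOpen_Ω.mem_nhds (hφ.2.1 _ (P.obs_mem k)))
    have ho := Asymptotics.isLittleO_iff.1 (hasGradientAt_iff_isLittleO.1 hd.hasGradientAt)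
      (show 0 < ε / (C + 1) by positivity)
    obtain ⟨δ, hδ, hball⟩ := Metric.eventually_nhds_iff.1 ho
    have hs : ∀ᶠ s : ℝ in 𝓝 0, C * |s| < δ :=
      (continuous_const.mul continuous_abs).continuousAt.eventually_lt continuousAt_const
        (by simpa using hδ)
    filter_upwards [hs] with s hs ψ hψ
    have h1 := hψ _ (P.obs_mem k)
    have h2 := hball (y := ψ (P.obs k)) (by rw [dist_eq_norm]; exact h1.trans_lt hs)
    rw [Real.norm_eq_abs] at h2
    refine h2.trans ?_
    calc ε / (C + 1) * ‖ψ (P.obs k) - φ (P.obs k)‖ ≤ ε / (C + 1) * ((C + 1) * |s|) := by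
          refine mul_le_mul_of_nonneg_left (h1.trans ?_) (by positivity)
          exact mul_le_mul_of_nonneg_right (by linarith) (abs_nonneg s)
      _ = ε * |s| := by field_simp
  filter_upwards [eventually_all.2 h] with s hs ψ hψ k using hs k ψ hψ

/-- Derivative of the Hamiltonian `L - ⟨η, f⟩`: its control part is the gradient, its state part the
right-hand side of the adjoint equation. -/
theorem inner_Lφ_sub_inner_fφ (hφ : P.IsForwardSolution u φ) {t : ℝ} (ht : t ∈ Icc 0 P.T) (s : ℝ)
    (x : EuclideanSpace ℝ (Fin N)) (y : EuclideanSpace ℝ (Fin l)) :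
    fderiv ℝ (fun p : EuclideanSpace ℝ (Fin N) × EuclideanSpace ℝ (Fin l) => P.L p.1 p.2)
        (u t, φ t) (s • x, y) -
      inner ℝ (η t) (fderiv ℝ (fun p : EuclideanSpace ℝ (Fin N) × EuclideanSpace ℝ (Fin l) =>
        P.f p.1 p.2) (u t, φ t) (s • x, y)) =
      s * inner ℝ (P.regularGradient u φ η t) x + inner ℝ (P.adjointRhs u φ η t) y := by
  have hΩ := hφ.2.1 t ht
  have hsplit : ((s • x, y) : EuclideanSpace ℝ (Fin N) × EuclideanSpace ℝ (Fin l)) =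
      s • (x, 0) + (0, y) := by ext1 <;> simp
  rw [hsplit, map_add, map_add, map_smul, map_smul, fderiv_L_inl _ _ hΩ, ← inner_Lφ hΩ,
    regularGradient, adjointRhs, inner_sub_left, inner_sub_left,
    ContinuousLinearMap.adjoint_inner_left, ContinuousLinearMap.adjoint_inner_left,
    fu_eq hΩ, fφ_eq hΩ, inner_add_right, inner_smul_right]
  simp only [ContinuousLinearMap.comp_apply, ContinuousLinearMap.inl_apply,
    ContinuousLinearMap.inr_apply, smul_eq_mul]
  ring

theorem memLp_L (hφ : P.IsForwardSolution u φ) (hu : u ∈ P.controls) :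
    MemLp (fun t => P.L (u t) (φ t)) ⊤ P.timeMeasure :=
  memLp_comp hu hφ.1 hφ.2.1 P.contDiffOn_L.continuousOn

/-- Exact formula for the remainder of the first order expansion of the objective. -/
theorem IsAdjointSolution.objective_sub_eq (hη : P.IsAdjointSolution u φ η)
    (hφ : P.IsForwardSolution u φ) (hu : u ∈ P.controls) (hv : v ∈ P.controls) {s : ℝ}
    (hψ : P.IsForwardSolution (u + s • v) ψ) :
    P.objective (u + s • v) ψ - P.objective u φ
        - s * P.euclideanMetric (P.regularGradient u φ η) v =
      (∫ t, ((P.L ((u + s • v) t) (ψ t) - P.L (u t) (φ t) -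
          fderiv ℝ (fun p : EuclideanSpace ℝ (Fin N) × EuclideanSpace ℝ (Fin l) => P.L p.1 p.2)
            (u t, φ t) (s • v t, ψ t - φ t)) -
        inner ℝ (η t) (P.f ((u + s • v) t) (ψ t) - P.f (u t) (φ t) -
          fderiv ℝ (fun p : EuclideanSpace ℝ (Fin N) × EuclideanSpace ℝ (Fin l) => P.f p.1 p.2)
            (u t, φ t) (s • v t, ψ t - φ t))) ∂P.timeMeasure) -
      ∑ k, (P.F k (ψ (P.obs k)) - P.F k (φ (P.obs k)) -
        inner ℝ (gradient (P.F k) (φ (P.obs k))) (ψ (P.obs k) - φ (P.obs k))) := by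
  have hw := add_smul_mem_controls hu hv s
  -- This identity cancels the two adjoint integrals left over from `hpt` against the linear
  -- observation terms.
  have hsum := hη.sum_inner_gradient_eq hφ hu hψ hw
  have i1 : Integrable (fun t => P.L ((u + s • v) t) (ψ t)) P.timeMeasure :=
    (memLp_L hψ hw).integrable le_top
  have i2 : Integrable (fun t => P.L (u t) (φ t)) P.timeMeasure :=
    (memLp_L hφ hu).integrable le_top
  have i3 : Integrable (fun t => s * inner ℝ (P.regularGradient u φ η t) (v t)) P.timeMeasure :=
    ((memLp_inner (hφ.regularGradient_mem_controls hu hη.memLp) hv).integrable le_top).const_mul s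
  have i4 : Integrable (fun t => inner ℝ (P.adjointRhs u φ η t) (ψ t - φ t)) P.timeMeasure :=
    (memLp_inner (hφ.memLp_adjointRhs hu hη.memLp)
      (memLp_of_continuousOn (hψ.1.sub hφ.1))).integrable le_top
  have i5 : Integrable (fun t => inner ℝ (η t) (P.f ((u + s • v) t) (ψ t) - P.f (u t) (φ t)))
      P.timeMeasure :=
    (memLp_inner hη.memLp ((hψ.memLp_f hw).sub (hφ.memLp_f hu))).integrable le_top
  have hpt : ∀ t ∈ Icc 0 P.T, (P.L ((u + s • v) t) (ψ t) - P.L (u t) (φ t) -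
        fderiv ℝ (fun p : EuclideanSpace ℝ (Fin N) × EuclideanSpace ℝ (Fin l) => P.L p.1 p.2)
          (u t, φ t) (s • v t, ψ t - φ t)) -
      inner ℝ (η t) (P.f ((u + s • v) t) (ψ t) - P.f (u t) (φ t) -
        fderiv ℝ (fun p : EuclideanSpace ℝ (Fin N) × EuclideanSpace ℝ (Fin l) => P.f p.1 p.2)
          (u t, φ t) (s • v t, ψ t - φ t)) =
      P.L ((u + s • v) t) (ψ t) - P.L (u t) (φ t)
        - s * inner ℝ (P.regularGradient u φ η t) (v t)
        - inner ℝ (P.adjointRhs u φ η t) (ψ t - φ t)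
        - inner ℝ (η t) (P.f ((u + s • v) t) (ψ t) - P.f (u t) (φ t)) := fun t ht => by
    have := inner_Lφ_sub_inner_fφ (η := η) hφ ht s (v t) (ψ t - φ t)
    rw [inner_sub_right (η t) (P.f ((u + s • v) t) (ψ t) - P.f (u t) (φ t))]
    linarith
  have j2 : Integrable (fun t => P.L ((u + s • v) t) (ψ t) - P.L (u t) (φ t)) P.timeMeasure :=
    i1.sub i2
  have j3 : Integrable (fun t => P.L ((u + s • v) t) (ψ t) - P.L (u t) (φ t) -
      s * inner ℝ (P.regularGradient u φ η t) (v t)) P.timeMeasure := j2.sub i3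
  have j4 : Integrable (fun t => P.L ((u + s • v) t) (ψ t) - P.L (u t) (φ t) -
      s * inner ℝ (P.regularGradient u φ η t) (v t) -
      inner ℝ (P.adjointRhs u φ η t) (ψ t - φ t)) P.timeMeasure := j3.sub i4
  rw [integral_congr_ae (P.ae_mem_Icc.mono hpt), integral_sub j4 i5, integral_sub j3 i4,
    integral_sub j2 i3, integral_sub i1 i2,
    integral_const_mul, objective, objective, euclideanMetric, P.intervalIntegral_eq,
    P.intervalIntegral_eq, P.intervalIntegral_eq]
  simp only [Finset.sum_sub_distrib, hsum]
  ring

/-- The Gateaux derivative of the objective is represented by `g(φ) u - f_uᵀ η`. -/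
theorem IsAdjointSolution.hasDerivAt_reducedObjective (hη : P.IsAdjointSolution u φ η)
    (hφ : P.IsForwardSolution u φ) (hu : u ∈ P.controls) (hv : v ∈ P.controls) :
    HasDerivAt (fun s : ℝ => P.reducedObjective (u + s • v))
      (P.euclideanMetric (P.regularGradient u φ η) v) 0 := by
  obtain ⟨C, hC, hev⟩ := hφ.exists_perturbation hu hv
  obtain ⟨M, hM0, hM⟩ := exists_ae_norm_le hη.memLp
  rw [hasDerivAt_iff_isLittleO, Asymptotics.isLittleO_iff]
  intro c hc
  have hT := P.T_pos
  -- Error budget: `T` for the remainder of `L`, `M T` for that of `f` paired with `η`, `K` for the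
  -- observations.
  set D : ℝ := P.T + M * P.T + K + 1 with hD
  have hD0 : 0 < D := by positivity
  have hε : 0 < c / D := div_pos hc hD0
  filter_upwards [hev, eventually_ae_norm_remainder_le P.contDiffOn_L hφ hu hv (C := C) hε,
    eventually_ae_norm_remainder_le P.contDiffOn_f hφ hu hv (C := C) hε,
    eventually_abs_observation_remainder_le hφ hC hε] with s ⟨ψ, hψ, hclose⟩ hsL hsf hsF
  have hw := add_smul_mem_controls hu hv s
  rw [zero_smul, add_zero, sub_zero, smul_eq_mul, hψ.reducedObjective_eq hw,
    hφ.reducedObjective_eq hu, hη.objective_sub_eq hφ hu hv hψ]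
  have h1 : ‖∫ t, ((P.L ((u + s • v) t) (ψ t) - P.L (u t) (φ t) -
          fderiv ℝ (fun p : EuclideanSpace ℝ (Fin N) × EuclideanSpace ℝ (Fin l) => P.L p.1 p.2)
            (u t, φ t) (s • v t, ψ t - φ t)) -
        inner ℝ (η t) (P.f ((u + s • v) t) (ψ t) - P.f (u t) (φ t) -
          fderiv ℝ (fun p : EuclideanSpace ℝ (Fin N) × EuclideanSpace ℝ (Fin l) => P.f p.1 p.2)
            (u t, φ t) (s • v t, ψ t - φ t))) ∂P.timeMeasure‖
      ≤ (c / D * |s| + M * (c / D * |s|)) * P.T := by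
    have hvol : P.timeMeasure.real univ = P.T := by
      simp [timeMeasure, Measure.real, hT.le]
    rw [← hvol]
    refine norm_integral_le_of_norm_le_const ?_
    filter_upwards [hsL ψ hclose, hsf ψ hclose, hM] with t hL hf hMt
    refine (norm_sub_le _ _).trans (add_le_add hL ((norm_inner_le_norm _ _).trans ?_))
    exact mul_le_mul hMt hf (norm_nonneg _) hM0
  have h2 : ‖∑ k, (P.F k (ψ (P.obs k)) - P.F k (φ (P.obs k)) -
        inner ℝ (gradient (P.F k) (φ (P.obs k))) (ψ (P.obs k) - φ (P.obs k)))‖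
      ≤ K * (c / D * |s|) := by
    refine (norm_sum_le_of_le _ fun k _ => hsF ψ hclose k).trans ?_
    simp
  refine (norm_sub_le _ _).trans ((add_le_add h1 h2).trans ?_)
  rw [Real.norm_eq_abs]
  calc (c / D * |s| + M * (c / D * |s|)) * P.T + K * (c / D * |s|)
      = c / D * |s| * (P.T + M * P.T + K) := by ring
    _ ≤ c / D * |s| * D := by gcongr; linarith
    _ = c * |s| := by field_simp

end Gradient

end ControlProblem

/-! ### Steepest descent for a semidefinite bilinear form -/

section Descent

variable {N : ℕ} {𝒰 : Submodule ℝ (Signal N)} {J : Signal N → ℝ} {G : Signal N → Signal N → ℝ}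
  {u u' r : Signal N} {h : ℝ}

/-- Along a line the Lagrangian is a quadratic polynomial in `s`. Bilinearity is required on `𝒰`
only, because an integral metric need not be additive on arbitrary signals. -/
theorem hasDerivAt_lagrangian (hadd : ∀ x ∈ 𝒰, ∀ y ∈ 𝒰, ∀ z ∈ 𝒰, G (x + y) z = G x z + G y z)
    (hsmul : ∀ c : ℝ, ∀ x ∈ 𝒰, ∀ y ∈ 𝒰, G (c • x) y = c * G x y)
    (hsymm : ∀ x ∈ 𝒰, ∀ y ∈ 𝒰, G x y = G y x) (hu : u ∈ 𝒰) (hr : r ∈ 𝒰)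
    (hJ : ∀ v ∈ 𝒰, gateaux J u v = G r v) (hu' : u' ∈ 𝒰) {v : Signal N} (hv : v ∈ 𝒰) (ε c : ℝ) :
    HasDerivAt (fun s : ℝ => lagrangian J G u ε c (u' + s • v)) (G r v + c * G (u' - u) v) 0 := by
  have hp : u' - u ∈ 𝒰 := 𝒰.sub_mem hu' hu
  have hadd' : ∀ x ∈ 𝒰, ∀ y ∈ 𝒰, ∀ z ∈ 𝒰, G z (x + y) = G z x + G z y := fun x hx y hy z hz => by
    rw [hsymm z hz _ (𝒰.add_mem hx hy), hadd x hx y hy z hz, hsymm x hx z hz, hsymm y hy z hz]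
  have hsmul' : ∀ c : ℝ, ∀ x ∈ 𝒰, ∀ y ∈ 𝒰, G y (c • x) = c * G y x := fun c x hx y hy => by
    rw [hsymm y hy _ (𝒰.smul_mem c hx), hsmul c x hx y hy, hsymm x hx y hy]
  have heq : (fun s : ℝ => lagrangian J G u ε c (u' + s • v)) = fun s : ℝ =>
      J u + (G r (u' - u) + s * G r v) + c * (1 / 2 * (G (u' - u) (u' - u) +
        2 * s * G (u' - u) v + s ^ 2 * G v v) - ε) := by
    funext s
    have hsv := 𝒰.smul_mem s hv
    rw [lagrangian, add_sub_right_comm, hJ _ (𝒰.add_mem hp hsv), hadd' _ hp _ hsv _ hr,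
      hadd _ hp _ hsv _ (𝒰.add_mem hp hsv), hadd' _ hp _ hsv _ hp, hadd' _ hp _ hsv _ hsv,
      hsmul' _ _ hv _ hr, hsmul' _ _ hv _ hp, hsmul _ _ hv _ hp, hsmul _ _ hv _ hsv,
      hsmul' _ _ hv _ hv, hsymm v hv _ hp]
    ring
  rw [heq]
  have h1 : HasDerivAt (fun s : ℝ => s * G r v) (G r v) 0 := hasDerivAt_mul_const _
  have h2 : HasDerivAt (fun s : ℝ => 2 * s * G (u' - u) v) (2 * G (u' - u) v) 0 := by
    simpa using ((hasDerivAt_id (0 : ℝ)).const_mul 2).mul_const (G (u' - u) v)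
  have h3 : HasDerivAt (fun s : ℝ => s ^ 2 * G v v) 0 0 := by
    simpa using (hasDerivAt_pow 2 (0 : ℝ)).mul_const (G v v)
  have h4 := (((((h2.const_add (G (u' - u) (u' - u))).add h3).const_mul (1 / 2)).sub_const
    ε).const_mul c)
  refine (((h1.const_add (G r (u' - u))).const_add (J u)).add h4).congr_deriv ?_
  ring

/-- Steepest descent updates for a positive semidefinite metric `G` are characterised by the
representative `r` of the Gateaux derivative with respect to `G`. -/
theorem isSteepestDescentUpdate_iff
    (hadd : ∀ x ∈ 𝒰, ∀ y ∈ 𝒰, ∀ z ∈ 𝒰, G (x + y) z = G x z + G y z)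
    (hsmul : ∀ c : ℝ, ∀ x ∈ 𝒰, ∀ y ∈ 𝒰, G (c • x) y = c * G x y)
    (hsymm : ∀ x ∈ 𝒰, ∀ y ∈ 𝒰, G x y = G y x) (hnonneg : ∀ x ∈ 𝒰, 0 ≤ G x x)
    (hu : u ∈ 𝒰) (hr : r ∈ 𝒰) (hJ : ∀ v ∈ 𝒰, gateaux J u v = G r v) (hh : 0 < h) :
    IsSteepestDescentUpdate 𝒰 J G u h u' ↔
      u' ∈ 𝒰 ∧ ∀ v ∈ 𝒰, G (u' - u + h • r) v = 0 := by
  have hval : ∀ p ∈ 𝒰, ∀ v ∈ 𝒰, G (p + h • r) v = h * (G r v + 1 / h * G p v) :=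
    fun p hp v hv => by
      rw [hadd _ hp _ (𝒰.smul_mem h hr) _ hv, hsmul _ _ hr _ hv]
      field_simp
      ring
  constructor
  · rintro ⟨hu', ε, -, -, hstat⟩
    refine ⟨hu', fun v hv => ?_⟩
    have h1 := (hasDerivAt_lagrangian hadd hsmul hsymm hu hr hJ hu' hv ε (1 / h)).unique
      (hstat v hv)
    rw [hval _ (𝒰.sub_mem hu' hu) v hv, h1, mul_zero]
  · rintro ⟨hu', h0⟩
    have hp := 𝒰.sub_mem hu' hu
    have hstat : ∀ v ∈ 𝒰, G r v + 1 / h * G (u' - u) v = 0 := fun v hv => by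
      have h1 := h0 v hv
      rw [hval _ hp v hv] at h1
      exact (mul_eq_zero.1 h1).resolve_left hh.ne'
    -- Here `ε = ½ G(p, p)`. For a competitor with `G(q, q) = G(p, p)`, expanding `0 ≤ G(q - p, q -
    -- p)` gives `G(p, q) ≤ G(p, p)`. By stationarity the linearisation is `-G(p, ·) / h`, so it is
    -- smallest at `p`.
    refine ⟨hu', _, rfl, fun w hw hG => ?_, fun v hv => ?_⟩
    · have hq := 𝒰.sub_mem hw hu
      set p := u' - u
      set q := w - u
      have hdiff : q + (-1 : ℝ) • p ∈ 𝒰 := 𝒰.add_mem hq (𝒰.smul_mem _ hp)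
      have h1 := hnonneg _ hdiff
      rw [hadd _ hq _ (𝒰.smul_mem _ hp) _ hdiff, hsmul _ _ hp _ hdiff, hsymm _ hq _ hdiff,
        hsymm _ hp _ hdiff, hadd _ hq _ (𝒰.smul_mem _ hp) _ hq,
        hadd _ hq _ (𝒰.smul_mem _ hp) _ hp, hsmul _ _ hp _ hq, hsmul _ _ hp _ hp,
        hsymm _ hq _ hp] at h1
      have h2 : G p q ≤ G p p := by linarith
      have h3 : 1 / h * G p q ≤ 1 / h * G p p := mul_le_mul_of_nonneg_left h2 (by positivity)
      rw [hJ p hp, hJ q hq]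
      linarith [hstat p hp, hstat q hq]
    · exact (hasDerivAt_lagrangian hadd hsmul hsymm hu hr hJ hu' hv _ (1 / h)).congr_deriv
        (hstat v hv)

end Descent

/-! ### Regular and natural gradient descent updates -/

theorem matVec_matVec_inv {N : ℕ} {A : Matrix (Fin N) (Fin N) ℝ} (hA : IsUnit A.det)
    (x : EuclideanSpace ℝ (Fin N)) : matVec A (matVec A⁻¹ x) = x := by
  rw [matVec, matVec, ← mul_apply_eq_comp, ← map_mul, Matrix.mul_nonsing_inv _ hA,
    map_one]
  rfl

theorem inner_matVec_pos {N : ℕ} {A : Matrix (Fin N) (Fin N) ℝ} (hA : A.PosDef)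
    {x : EuclideanSpace ℝ (Fin N)} (hx : x ≠ 0) : 0 < inner ℝ x (matVec A x) := by
  rw [matVec, Matrix.inner_toEuclideanCLM]
  have := hA.dotProduct_mulVec_pos (x := x.ofLp) (by simpa using hx)
  simpa using this

namespace ControlProblem

variable {N l K : ℕ} {P : ControlProblem N l K} {u u' r : Signal N} {φ η : Signal l} {h : ℝ}

variable (P) in
/-- The space of controls as a linear subspace. -/
def controlSubmodule : Submodule ℝ (Signal N) where
  carrier := P.controls
  add_mem' := MemLp.add
  zero_mem' := MemLp.zero
  smul_mem' c _ hx := MemLp.const_smul hx c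

/-- Steepest descent updates for the metric `∫ v(t)ᵀ B(t) w(t) dt` given by symmetric positive
definite operators `B(t)`. -/
theorem isSteepestDescentUpdate_iff_ae
    {B : ℝ → EuclideanSpace ℝ (Fin N) →L[ℝ] EuclideanSpace ℝ (Fin N)}
    (hB : ∀ w ∈ P.controls, MemLp (fun t => B t (w t)) ⊤ P.timeMeasure)
    (hsymm : ∀ t ∈ Icc 0 P.T, ∀ x y, inner ℝ x (B t y) = inner ℝ (B t x) y)
    (hpos : ∀ t ∈ Icc 0 P.T, ∀ x, x ≠ 0 → 0 < inner ℝ x (B t x))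
    {J : Signal N → ℝ} {G : Signal N → Signal N → ℝ}
    (hG : ∀ v w, G v w = ∫ t in (0 : ℝ)..P.T, inner ℝ (v t) (B t (w t)))
    (hu : u ∈ P.controls) (hr : r ∈ P.controls)
    (hJ : ∀ v ∈ P.controls, HasDerivAt (fun s : ℝ => J (u + s • v)) (G r v) 0) (hh : 0 < h) :
    IsSteepestDescentUpdate P.controls J G u h u' ↔
      ∀ᵐ t ∂P.timeMeasure, u' t = u t - h • r t := by
  replace hG : ∀ v w, G v w = ∫ t, inner ℝ (v t) (B t (w t)) ∂P.timeMeasure := fun v w => by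
    rw [hG, P.intervalIntegral_eq]
  have hint : ∀ v ∈ P.controls, ∀ w ∈ P.controls,
      Integrable (fun t => inner ℝ (v t) (B t (w t))) P.timeMeasure := fun v hv w hw =>
    (memLp_inner hv (hB w hw)).integrable le_top
  have hnn : ∀ t ∈ Icc 0 P.T, ∀ x, 0 ≤ inner ℝ x (B t x) := fun t ht x => by
    by_cases hx : x = 0
    · simp [hx]
    · exact (hpos t ht x hx).le
  refine (isSteepestDescentUpdate_iff (𝒰 := P.controlSubmodule) (r := r)
    (fun x hx y hy z hz => ?_) (fun c x hx y hy => ?_) (fun x hx y hy => ?_) (fun x hx => ?_)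
    hu hr (fun v hv => (hJ v hv).deriv) hh).trans ?_
  · rw [hG, hG, hG, ← integral_add (hint x hx z hz) (hint y hy z hz)]
    simp only [Pi.add_apply, inner_add_left]
  · rw [hG, hG, ← integral_const_mul]
    simp only [Pi.smul_apply, real_inner_smul_left]
  · rw [hG, hG]
    refine integral_congr_ae (P.ae_mem_Icc.mono fun t ht => ?_)
    exact (hsymm t ht _ _).trans (real_inner_comm _ _)
  · rw [hG]
    exact integral_nonneg_of_ae (P.ae_mem_Icc.mono fun t ht => hnn t ht _)
  have hzero : ∀ t, (u' - u + h • r) t = 0 ↔ u' t = u t - h • r t := fun t => by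
    simp only [Pi.add_apply, Pi.sub_apply, Pi.smul_apply]
    rw [sub_add, sub_eq_zero]
  constructor
  · rintro ⟨hu', h0⟩
    -- The residual is itself a control and may serve as test direction; definiteness then kills it
    -- almost everywhere.
    have hq : u' - u + h • r ∈ P.controls := (MemLp.sub hu' hu).add (MemLp.const_smul hr h)
    have h1 := h0 _ hq
    rw [hG, integral_eq_zero_iff_of_nonneg_ae (P.ae_mem_Icc.mono fun t ht => hnn t ht _)
      (hint _ hq _ hq)] at h1
    filter_upwards [h1, P.ae_mem_Icc] with t h2 ht
    refine (hzero t).1 (not_not.1 fun hne => ?_)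
    exact (hpos t ht _ hne).ne' h2
  · intro hae
    refine ⟨MemLp.ae_eq (hae.mono fun t ht => ht.symm) (MemLp.sub hu (MemLp.const_smul hr h)),
      fun v _ => ?_⟩
    rw [hG]
    refine integral_eq_zero_of_ae (hae.mono fun t ht => ?_)
    simp only [(hzero t).2 ht, inner_zero_left, Pi.zero_apply]

theorem IsForwardSolution.naturalGradient_mem_controls (hφ : P.IsForwardSolution u φ)
    (hu : u ∈ P.controls) (hη : MemLp η ⊤ P.timeMeasure)
    (hg : ∀ t ∈ Icc 0 P.T, (P.g (φ t)).PosDef) : P.naturalGradient u φ η ∈ P.controls := by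
  -- Matrix inversion is continuous where the determinant does not vanish, and positive definiteness
  -- keeps the trajectory there.
  set U : Set (EuclideanSpace ℝ (Fin l)) := {x ∈ P.Ω | (P.g x).det ≠ 0}
  have hinv : ContinuousOn (fun x => (P.g x)⁻¹) U := fun x hx => by
    have h1 : ContinuousAt Ring.inverse (P.g x).det := by
      rw [Ring.inverse_eq_inv']
      exact continuousAt_inv₀ hx.2
    exact (continuousAt_matrix_inv _ h1).comp_continuousWithinAt
      ((P.continuousOn_g x hx.1).mono fun _ hy => hy.1)
  have hc : ContinuousOn (fun q : (EuclideanSpace ℝ (Fin N) × EuclideanSpace ℝ (Fin l)) ×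
      EuclideanSpace ℝ (Fin N) => (P.g q.1.2)⁻¹) ((univ ×ˢ U) ×ˢ univ) :=
    hinv.comp (continuous_snd.comp continuous_fst).continuousOn fun _ hq => hq.1.2
  have h1 := memLp_comp_prod hu hφ.1
    (fun t ht => (⟨hφ.2.1 t ht, (hg t ht).det_pos.ne'⟩ : φ t ∈ U))
    (memLp_adjoint_apply (hφ.memLp_fu hu) hη)
    (continuous_matVec.comp_continuousOn (hc.prodMk continuousOn_snd))
  exact MemLp.sub hu h1

/-- Pointwise `g` maps the natural gradient to the regular one, and symmetry lets `g` act on the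
first argument. -/
theorem IsForwardSolution.fisherMetric_naturalGradient (hφ : P.IsForwardSolution u φ)
    (hg : ∀ t ∈ Icc 0 P.T, (P.g (φ t)).PosDef) (v : Signal N) :
    P.fisherMetric φ (P.naturalGradient u φ η) v =
      P.euclideanMetric (P.regularGradient u φ η) v := by
  refine intervalIntegral.integral_congr fun t ht => ?_
  rw [uIcc_of_le P.T_pos.le] at ht
  have h1 : matVec (P.g (φ t)) (P.naturalGradient u φ η t) = P.regularGradient u φ η t := by
    have h2 := matVec_matVec_inv (isUnit_iff_ne_zero.2 (hg t ht).det_pos.ne')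
      ((ContinuousLinearMap.adjoint (P.fu u φ t)) (η t))
    rw [naturalGradient, regularGradient]
    exact (map_sub (Matrix.toEuclideanCLM (n := Fin N) (𝕜 := ℝ) (P.g (φ t))) _ _).trans
      (congrArg (matVec (P.g (φ t)) (u t) - ·) h2)
  simp only [inner_matVec_comm (P.g_symm _ (hφ.2.1 t ht)), h1]

end ControlProblem

theorem proposition2 {N l K : ℕ} (P : ControlProblem N l K)
    (u : Signal N) (hu : u ∈ P.controls)
    (φ : Signal l) (hφ : P.IsForwardSolution u φ) :
    -- the control determines the moments on `[0, T]`, so that `J` is a functional of the control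
    (∀ w ∈ P.controls, ∀ ψ, P.IsForwardSolution w ψ →
      (∀ ψ', P.IsForwardSolution w ψ' → EqOn ψ' ψ (Icc 0 P.T)) ∧
        P.reducedObjective w = P.objective w ψ) ∧
    -- the forward equation remains solvable under small perturbations of the control
    (∀ v ∈ P.controls, ∀ᶠ s : ℝ in 𝓝 0, ∃ ψ, P.IsForwardSolution (u + s • v) ψ) ∧
    -- the adjoint equation has exactly one solution on `[0, T]`
    (∃ η, P.IsAdjointSolution u φ η ∧
      ∀ η', P.IsAdjointSolution u φ η' → EqOn η' η (Icc 0 P.T)) ∧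
    ∀ η, P.IsAdjointSolution u φ η →
      -- the gradient of `J` for the Euclidean metric, and regular gradient descent
      (∀ v ∈ P.controls, HasDerivAt (fun s : ℝ => P.reducedObjective (u + s • v))
        (P.euclideanMetric (P.regularGradient u φ η) v) 0) ∧
      (∀ h : ℝ, 0 < h → ∀ u' : Signal N,
        IsSteepestDescentUpdate P.controls P.reducedObjective P.euclideanMetric u h u' ↔
          ∀ᵐ t ∂P.timeMeasure, u' t = u t - h • (matVec (P.g (φ t)) (u t)
            - (ContinuousLinearMap.adjoint (P.fu u φ t)) (η t))) ∧
      -- the gradient of `J` for the Fisher metric, and natural gradient descent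
      ((∀ t ∈ Icc 0 P.T, (P.g (φ t)).PosDef) →
        (∀ v ∈ P.controls, HasDerivAt (fun s : ℝ => P.reducedObjective (u + s • v))
          (P.fisherMetric φ (P.naturalGradient u φ η) v) 0) ∧
        (∀ h : ℝ, 0 < h → ∀ u' : Signal N,
          IsSteepestDescentUpdate P.controls P.reducedObjective (P.fisherMetric φ) u h u' ↔
            ∀ᵐ t ∂P.timeMeasure, u' t = u t - h • (u t
              - matVec (P.g (φ t))⁻¹ ((ContinuousLinearMap.adjoint (P.fu u φ t)) (η t))))) := by
  refine ⟨fun w hw ψ hψ => ⟨fun ψ' hψ' => hψ.eqOn hψ' hw, hψ.reducedObjective_eq hw⟩,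
    fun v hv => ?_, ?_, fun η hη => ?_⟩
  · obtain ⟨C, -, hC⟩ := hφ.exists_perturbation hu hv
    exact hC.mono fun s ⟨ψ, hψ, _⟩ => ⟨ψ, hψ⟩
  · obtain ⟨η, hη⟩ := hφ.exists_isAdjointSolution hu
    exact ⟨η, hη, fun η' hη' => hη.eqOn hη' hφ hu⟩
  · have hJ := fun v hv => hη.hasDerivAt_reducedObjective (v := v) hφ hu hv
    refine ⟨hJ, fun h hh u' => ?_, fun hg => ?_⟩
    · exact ControlProblem.isSteepestDescentUpdate_iff_ae
        (B := fun _ => ContinuousLinearMap.id ℝ _) (fun w hw => hw) (fun _ _ _ _ => rfl)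
        (fun _ _ x hx => real_inner_self_pos.2 hx) (fun _ _ => rfl) hu
        (hφ.regularGradient_mem_controls hu hη.memLp) hJ hh
    · have hJ' : ∀ v ∈ P.controls, HasDerivAt (fun s : ℝ => P.reducedObjective (u + s • v))
          (P.fisherMetric φ (P.naturalGradient u φ η) v) 0 := fun v hv => by
        rw [hφ.fisherMetric_naturalGradient hg]
        exact hJ v hv
      refine ⟨hJ', fun h hh u' => ?_⟩
      exact ControlProblem.isSteepestDescentUpdate_iff_ae
        (B := fun t => Matrix.toEuclideanCLM (n := Fin N) (𝕜 := ℝ) (P.g (φ t)))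
        (fun w hw => hφ.memLp_matVec_g hw)
        (fun t ht x y => inner_matVec_comm (P.g_symm _ (hφ.2.1 t ht)) x y)
        (fun t ht x hx => inner_matVec_pos (hg t ht) hx) (fun _ _ => rfl) hu
        (hφ.naturalGradient_mem_controls hu hη.memLp hg) hJ' hh
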